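/- **The monotone universe hierarchy.** By recursion on $n\in\mathbb N$ one defines: a type $\mathbb U_n$ of *codes* of level $n$; for each code $A$ a type $\mathrm{El}\,A$ with a relation $\sqsubseteq^A$ on it; for $A:\mathbb U_m$ and $B:\mathbb U_n$ with $m\le n$ a type $A\sqsubseteq B$ of *derivations of precision*; and for each derivation $d$ of $A\sqsubseteq B$ a relation ${}_A{\sqsubseteq}_B\subseteq \mathrm{El}\,A\times\mathrm{El}\,B$ (depending on $d$, which is suppressed). (Between a code of level $m$ and a code of level $n<m$ there is no derivation.) *Codes of level $n$:* $\mathsf{err}_n$, $\mathsf{?}_n$, $\mathsf{nat}$, $\mathsf u_j$ for $j<n$, and $\Pi\,A\,B$ for $A:\mathbb U_i$ and $B:\mathrm{El}\,A\to\mathbb U_j$ with $\max(i,j)+1=n$, where $B$ is equipped with a derivation of $B\,a\sqsubseteq B\,a'$ whenever $a\sqsubseteq^A a'$. The *head* of $\mathsf{nat}$, $\mathsf u_j$, $\Pi\,A\,B$ is $\mathsf{nat}$, $\mathsf u_j$, $\Pi$ respectively. The heads that exist at level $n$ are $\mathsf{nat}$, $\mathsf u_j$ for $j<n$, and $\Pi$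 if $n\ge 1$; their *germs* are $g_n(\mathsf{nat})=\mathsf{nat}$, $g_n(\mathsf u_j)=\mathsf u_j$ and $g_n(\Pi)=\Pi\,\mathsf ?_{n-1}\,(\lambda a.\,\mathsf ?_{n-1})$. *Decoding and orders.* - $\mathrm{El}\,\mathsf{err}_n$ is the one-point type. - $\mathrm{El}\,\mathsf{nat}$ is the inductive type with constructors $\mathsf{err},\mathsf ?,0,\mathsf S$, and its order is generated by $\mathsf{err}\sqsubseteq x$; $\mathsf ?\sqsubseteq\mathsf ?$; $0\sqsubseteq 0$; $0\sqsubseteq\mathsf ?$; $\mathsf Sx\sqsubseteq\mathsf Sy$ if $x\sqsubseteq y$; $\mathsf Sx\sqsubseteq\mathsf ?$ if $x\sqsubseteq\mathsf ?$. - $\mathrm{El}\,\mathsf u_j=\mathbb U_j$, ordered by (the existence of a derivation of) precision. - $\mathrm{El}(\Pi\,A\,B)$ is the type of monotone dependent functions, i.e. $f:\Pi(a:\mathrm{El}\,A).\,\mathrm{El}(B\,a)$ such that $f\,a\ {}_{B a}{\sqsubseteq}_{B a'}\ f\,a'$ whenever $a\sqsubseteq^A a'$, ordered pointwise. - $\mathrm{El}\,\mathsf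 ?_n$ consists of $\mathsf{err}$, $\mathsf ?$ and pairs $[h;x]$ of a head $h$ that exists at level $n$ and an $x:\mathrm{El}\,g_n(h)$, where all pairs $[h;\mathsf{err}]$ are identified with $\mathsf{err}$ (the error of $\mathrm{El}\,\mathsf u_j$ is $\mathsf{err}_j$, that of a product is the function with constant value the error). Its order is generated by $\mathsf{err}\sqsubseteq z$; $\mathsf ?\sqsubseteq\mathsf ?$; $[h;x]\sqsubseteq\mathsf ?$; $[h;x]\sqsubseteq[h;x']$ if $x\sqsubseteq^{g_n(h)}x'$. *Rules for derivations of precision from level $m$ to level $n\ge m$:* $\mathsf{err}_m\sqsubseteq A$; $\mathsf{nat}\sqsubseteq\mathsf{nat}$; $\mathsf u_j\sqsubseteq\mathsf u_j$; $\mathsf ?_m\sqsubseteq\mathsf ?_n$; $\Pi\,A\,B\sqsubseteq\Pi\,A'\,B'$ from a derivation of $A\sqsubseteq A'$ and, for all $a\ {}_A{\sqsubseteq}_{A'}\ a'$, a derivation of $B\,a\sqsubseteq B'\,a'$; and $A\sqsubseteq\mathsf ?_n$ if $A$ has a head $h$ that exists at level $n$, from a derivation of $A\sqsubseteq g_n(h)$.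 *The relations ${}_A{\sqsubseteq}_B$ of these derivations:* all pairs, for $\mathsf{err}_m\sqsubseteq A$; the order of $\mathrm{El}\,\mathsf{nat}$ or $\mathrm{El}\,\mathsf u_j$, for $\mathsf{nat}\sqsubseteq\mathsf{nat}$ and $\mathsf u_j\sqsubseteq\mathsf u_j$; for products, $f$ is related to $f'$ if $f\,a\ {}_{B a}{\sqsubseteq}_{B'a'}\ f'\,a'$ whenever $a\ {}_A{\sqsubseteq}_{A'}\ a'$; for $\mathsf ?_m\sqsubseteq\mathsf ?_n$, the relation generated by: $\mathsf{err}$ is related to each $z$, each $z$ to $\mathsf ?$, and $[h;x]$ to $[h;x']$ if $x\ {}_{g_m(h)}{\sqsubseteq}_{g_n(h)}\ x'$; for $A\sqsubseteq\mathsf ?_n$ with $A$ of head $h$, $a$ is related to $\mathsf ?$, and to each $z$ such that $[h;x]\sqsubseteq z$ for some $x$ with $a\ {}_A{\sqsubseteq}_{g_n(h)}\ x$. An *ep-pair* between posets $X$ and $Y$ is a relation $d\subseteq X\times Y$ such that $x'\sqsubseteq x$, $d(x,y)$ and $y\sqsubseteq y'$ imply $d(x',y')$, for which there are maps ${\uparrow}:X\to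 Y$ and ${\downarrow}:Y\to X$ with ${\uparrow}x\sqsubseteq y\Leftrightarrow d(x,y)\Leftrightarrow x\sqsubseteq{\downarrow}y$ and ${\downarrow}\,{\uparrow}x=x$. **Theorem (Properties of the universe hierarchy).** 1. Precision between codes (of arbitrary levels) is reflexive, transitive, antisymmetric, and irrelevant, i.e. $A\sqsubseteq B$ has at most one derivation. In particular each $(\mathbb U_i,\sqsubseteq)$ is a poset. 2. $\mathsf{err}_i\sqsubseteq A$ and $A\sqsubseteq\mathsf ?_i$ for all $A:\mathbb U_i$. 3. $\mathrm{El}$ is a family of posets with relations ${}_A{\sqsubseteq}_B$: each $(\mathrm{El}\,A,\sqsubseteq^A)$ is a poset with a least and a greatest element; ${}_A{\sqsubseteq}_B$ is an ep-pair from $\mathrm{El}\,A$ to $\mathrm{El}\,B$ whenever $A\sqsubseteq B$; ${}_A{\sqsubseteq}_A$ is $\sqsubseteq^A$; and ${}_A{\sqsubseteq}_C$ is the relational composite of ${}_A{\sqsubseteq}_B$ and ${}_B{\sqsubseteq}_C$ whenever $A\sqsubseteq B\sqsubseteq C$. 4. $\mathbb U_i$ and all $\mathrm{El}\,A$ satisfy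 uniqueness of identity proofs. -/

import Mathlib

namespace MonotoneModel

/-! ### Universe levels, extended natural numbers -/

/-- The universe levels `< n`: `last` is the level `n`, seen among the levels `< n + 1`; `prev i` is the
level `i < n`, seen among the levels `< n + 1`. -/
inductive Lvl : ℕ → Type
  | last {n : ℕ} : Lvl (n + 1)
  | prev {n : ℕ} (i : Lvl n) : Lvl (n + 1)

/-- The level, as a natural number. -/
def Lvl.val : {n : ℕ} → Lvl n → ℕ
  | n + 1, .last => n
  | _ + 1, .prev i => i.val

theorem Lvl.val_lt : ∀ {n : ℕ} (i : Lvl n), i.val < n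
  | _ + 1, .last => Nat.lt_succ_self _
  | _ + 1, .prev i => Nat.lt_succ_of_lt i.val_lt

/-- Natural numbers with two freely added constructors, an error and an unknown element. -/
inductive LNat : Type
  | err : LNat
  | unk : LNat
  | zero : LNat
  | succ (x : LNat) : LNat

/-- The precision order on extended natural numbers. -/
inductive LNat.Le : LNat → LNat → Prop
  | err (x : LNat) : LNat.Le .err x
  | unk : LNat.Le .unk .unk
  | zero : LNat.Le .zero .zero
  | zero_unk : LNat.Le .zero .unk
  | succ {x y : LNat} : LNat.Le x y → LNat.Le (.succ x) (.succ y)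
  | succ_unk {x : LNat} : LNat.Le x .unk → LNat.Le (.succ x) .unk

/-! ### Notions of order theory -/

/-- `d` underlies an embedding-projection pair from the poset `(α, leA)` to the poset `(β, leB)`. -/
structure IsEpPair {α β : Type} (leA : α → α → Prop) (leB : β → β → Prop)
    (d : α → β → Prop) : Prop where
  closed : ∀ a' a b b', leA a' a → d a b → leB b b' → d a' b'
  represented : ∃ (up : α → β) (down : β → α),
    (∀ a b, leB (up a) b ↔ d a b) ∧ (∀ a b, d a b ↔ leA a (down b)) ∧ ∀ a, down (up a) = a

/-- The identity type, as a type of proofs. (Lean's `=` is a proposition, any two proofs of which are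
identified by definition.) -/
inductive Ident {α : Type} (a : α) : α → Type
  | refl : Ident a a

/-- Uniqueness of identity proofs. -/
def UIP (α : Type) : Prop := ∀ (a b : α) (p q : Ident a b), p = q

/-! ### One step of the construction

The codes of level `n` only refer to codes of levels `< n`: a product of a code of level `i` and a
family of codes of level `j` has level `max i j + 1`. So the universes are built by recursion on
the level, and a `Base n` holds what has to be known of the levels `< n` to define the level `n`. -/

/-- The data of the universes of codes of levels `< n`. -/
structure Base (n : ℕ) : Type 1 where
  /-- codes -/
  U : Lvl n → Type
  /-- decoding of codes to types -/
  El : {i : Lvl n} → U i → Type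
  /-- order on the decoding of a code -/
  le : {i : Lvl n} → (A : U i) → El A → El A → Prop
  /-- derivations of precision between codes -/
  Prec : {i j : Lvl n} → U i → U j → Type
  /-- decoding of derivations of precision to relations -/
  Rel : {i j : Lvl n} → {A : U i} → {B : U j} → Prec A B → El A → El B → Prop
  /-- the code of the error type -/
  err : (i : Lvl n) → U i
  /-- the code of the unknown type -/
  unk : (i : Lvl n) → U i
  unkRefl : (i : Lvl n) → Prec (unk i) (unk i)
  /-- the error of the unknown type -/
  unkErr : (i : Lvl n) → El (unk i)

/-- Monotone dependent functions. -/
def Base.PiMon {n : ℕ} (P : Base n) {i j : Lvl n} (A : P.U i) (B : P.El A → P.U j)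
    (mon : ∀ a a', P.le A a a' → P.Prec (B a) (B a')) : Type :=
  {f : ∀ a, P.El (B a) // ∀ (a a' : P.El A) (h : P.le A a a'), P.Rel (mon a a' h) (f a) (f a')}

/-- The codes of level `k` that start with a type constructor. The domain and the codomain
of a product are codes of levels `i` and `j` such that `max i j + 1 = k`. -/
inductive Ty {n : ℕ} (P : Base n) (k : ℕ) : Type
  | nat : Ty P k
  | univ (j : Lvl n) (h : j.val < k) : Ty P k
  | pi (i j : Lvl n) (h : max i.val j.val + 1 = k) (A : P.U i) (B : P.El A → P.U j)
      (mon : ∀ a a', P.le A a a' → P.Prec (B a) (B a')) : Ty P k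

/-- The codes of level `k`. -/
inductive Code {n : ℕ} (P : Base n) (k : ℕ) : Type
  | err : Code P k
  | unk : Code P k
  | ty (A : Ty P k) : Code P k

/-- Head constructors of types. -/
inductive Hd : Type
  | nat : Hd
  | univ (j : ℕ) : Hd
  | pi : Hd

/-- The head constructor of a type. -/
def Ty.hd {n : ℕ} {P : Base n} {k : ℕ} : Ty P k → Hd
  | .nat => .nat
  | .univ j _ => .univ j.val
  | .pi .. => .pi

/-- The head constructors that exist at level `k`: natural numbers, the universes of level
`< k` and, if `k ≥ 1`, the product, which comes with the level `k - 1`. -/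
inductive Head (n k : ℕ) : Type
  | nat : Head n k
  | univ (j : Lvl n) (h : j.val < k) : Head n k
  | pi (i : Lvl n) (h : i.val + 1 = k) : Head n k

def Head.hd {n k : ℕ} : Head n k → Hd
  | .nat => .nat
  | .univ j _ => .univ j.val
  | .pi .. => .pi

/-- The germ of a head constructor at level `k`, which is `? → ?` for the product,
where `?` is the unknown type of level `k - 1`. -/
def germ {n : ℕ} (P : Base n) {k : ℕ} : Head n k → Ty P k
  | .nat => .nat
  | .univ j h => .univ j h
  | .pi i h => .pi i i (by simpa using h) (P.unk i) (fun _ => P.unk i) (fun _ _ _ => P.unkRefl i)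

/-- Decoding of the codes that start with a type constructor. -/
def ElTy {n : ℕ} {P : Base n} {k : ℕ} : Ty P k → Type
  | .nat => LNat
  | .univ j _ => P.U j
  | .pi _ _ _ A B mon => P.PiMon A B mon

/-- The order on `ElTy A`; it is pointwise on products. -/
def leTy {n : ℕ} {P : Base n} {k : ℕ} : (A : Ty P k) → ElTy A → ElTy A → Prop
  | .nat, x, y => LNat.Le x y
  | .univ _ _, X, Y => Nonempty (P.Prec X Y)
  | .pi _ _ _ _ B _, f, g => ∀ a, P.le (B a) (f.1 a) (g.1 a)

/-- A type with the constructors of the unknown type of level `k`. -/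
structure UnkStr {n : ℕ} (P : Base n) (k : ℕ) : Type 1 where
  X : Type
  err : X
  top : X
  inj : (h : Head n k) → ElTy (germ P h) → X

/-- The order on the unknown type. -/
inductive UnkLe {n : ℕ} {P : Base n} {k : ℕ} (S : UnkStr P k) : S.X → S.X → Prop
  | err (z : S.X) : UnkLe S S.err z
  | top : UnkLe S S.top S.top
  | inj (h : Head n k) {x x' : ElTy (germ P h)} :
      leTy (germ P h) x x' → UnkLe S (S.inj h x) (S.inj h x')
  | inj_top (h : Head n k) (x : ElTy (germ P h)) : UnkLe S (S.inj h x) S.top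

/-- Decoding of codes, given the unknown type. -/
def ElCode {n : ℕ} {P : Base n} {k : ℕ} (X : Type) : Code P k → Type
  | .err => Unit
  | .unk => X
  | .ty A => ElTy A

/-- The order on `ElCode S.X A`. -/
def leCode {n : ℕ} {P : Base n} {k : ℕ} (S : UnkStr P k) :
    (A : Code P k) → ElCode S.X A → ElCode S.X A → Prop
  | .err, _, _ => True
  | .unk, x, y => UnkLe S x y
  | .ty A, x, y => leTy A x y

/-- Derivations of precision between codes that start with a type constructor. -/
inductive PrecTy {n : ℕ} {P : Base n} : {k m : ℕ} → Ty P k → Ty P m → Type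
  | nat {k m : ℕ} (hkm : k ≤ m) : PrecTy (.nat : Ty P k) (.nat : Ty P m)
  | univ {k m : ℕ} (hkm : k ≤ m) (j : Lvl n) (h : j.val < k) (h' : j.val < m) :
      PrecTy (.univ j h : Ty P k) (.univ j h' : Ty P m)
  | pi {k m : ℕ} (hkm : k ≤ m) {i j i' j' : Lvl n} {h : max i.val j.val + 1 = k}
      {h' : max i'.val j'.val + 1 = m}
      {A : P.U i} {B : P.El A → P.U j} {mon : ∀ a a', P.le A a a' → P.Prec (B a) (B a')}
      {A' : P.U i'} {B' : P.El A' → P.U j'} {mon' : ∀ a a', P.le A' a a' → P.Prec (B' a) (B' a')}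
      (dom : P.Prec A A') (cod : ∀ a a', P.Rel dom a a' → P.Prec (B a) (B' a')) :
      PrecTy (.pi i j h A B mon : Ty P k) (.pi i' j' h' A' B' mon' : Ty P m)

/-- Derivations of precision between codes. -/
inductive PrecCode {n : ℕ} {P : Base n} : {k m : ℕ} → Code P k → Code P m → Type
  | err {k m : ℕ} (hkm : k ≤ m) (A : Code P m) : PrecCode (.err : Code P k) A
  | unk {k m : ℕ} (hkm : k ≤ m) : PrecCode (.unk : Code P k) (.unk : Code P m)
  | diag {k m : ℕ} {A : Ty P k} {A' : Ty P m} (d : PrecTy A A') : PrecCode (.ty A) (.ty A')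
  | head {k m : ℕ} {A : Ty P k} (h : Head n m) (hA : A.hd = h.hd) (d : PrecTy A (germ P h)) :
      PrecCode (.ty A) (.unk : Code P m)

/-- Precision on terms induced by `d : PrecTy A A'`. -/
def RelTy {n : ℕ} {P : Base n} : {k m : ℕ} → {A : Ty P k} → {A' : Ty P m} → PrecTy A A' →
    ElTy A → ElTy A' → Prop
  | _, _, _, _, .nat _, x, y => LNat.Le x y
  | _, _, _, _, .univ _ _ _ _, X, Y => Nonempty (P.Prec X Y)
  | _, _, _, _, .pi _ dom cod, f, f' =>
      ∀ a a' (r : P.Rel dom a a'), P.Rel (cod a a' r) (f.1 a) (f'.1 a')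

/-- Precision on terms between unknown types. -/
inductive RelUnk {n : ℕ} {P : Base n} {k m : ℕ} (S : UnkStr P k) (S' : UnkStr P m) :
    S.X → S'.X → Prop
  | err (z : S'.X) : RelUnk S S' S.err z
  | top (z : S.X) : RelUnk S S' z S'.top
  | inj (h : Head n k) (h' : Head n m) (hh : h.hd = h'.hd) (d : PrecTy (germ P h) (germ P h'))
      {x : ElTy (germ P h)} {x' : ElTy (germ P h')} :
      RelTy d x x' → RelUnk S S' (S.inj h x) (S'.inj h' x')

/-- Precision on terms between a type with head constructor `h` and an unknown type. In the
first rule, `z` may be `inj h x`, but also any element if `inj h x` is the error. -/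
inductive RelHead {n : ℕ} {P : Base n} {k m : ℕ} (S' : UnkStr P m) {A : Ty P k} (h : Head n m)
    (d : PrecTy A (germ P h)) : ElTy A → S'.X → Prop
  | inj {a : ElTy A} {x : ElTy (germ P h)} {z : S'.X} :
      RelTy d a x → UnkLe S' (S'.inj h x) z → RelHead S' h d a z
  | top (a : ElTy A) : RelHead S' h d a S'.top

/-- Precision on terms induced by `d : PrecCode A A'`. -/
def RelCode {n : ℕ} {P : Base n} {k m : ℕ} (S : UnkStr P k) (S' : UnkStr P m) :
    {A : Code P k} → {A' : Code P m} → PrecCode A A' → ElCode S.X A → ElCode S'.X A' → Prop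
  | _, _, .err _ _, _, _ => True
  | _, _, .unk _, x, y => RelUnk S S' x y
  | _, _, .diag d, x, y => RelTy d x y
  | _, _, .head h _ d, x, y => RelHead S' h d x y

/-! The unknown type of level `n`, as a quotient. -/

/-- The errors of germs; the error of a product is the function with value the error. -/
def IsErr {n : ℕ} (P : Base n) {k : ℕ} : (h : Head n k) → ElTy (germ P h) → Prop
  | .nat, x => x = LNat.err
  | .univ j _, x => x = P.err j
  | .pi i _, f => ∀ a, f.1 a = P.unkErr i

/-- Extended dependent pairs of a head constructor and an element of its germ. -/
inductive PreUnk {n : ℕ} (P : Base n) : Type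
  | err : PreUnk P
  | top : PreUnk P
  | inj (h : Head n n) (x : ElTy (germ P h)) : PreUnk P

/-- All errors of germs are glued to the error. -/
inductive PreUnk.Glue {n : ℕ} (P : Base n) : PreUnk P → PreUnk P → Prop
  | inj_err (h : Head n n) (x : ElTy (germ P h)) (hx : IsErr P h x) :
      PreUnk.Glue P (.inj h x) .err

/-- The unknown type of level `n`. -/
def unkStr {n : ℕ} (P : Base n) : UnkStr P n where
  X := Quot (PreUnk.Glue P)
  err := Quot.mk _ .err
  top := Quot.mk _ .top
  inj h x := Quot.mk _ (.inj h x)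

/-! ### The hierarchy -/

/-- A `Base n`, with the description of the codes of levels `< n` and of their decodings
that is needed to compare these codes with the codes of level `n`. -/
structure Hier (n : ℕ) : Type 1 extends Base n where
  /-- a code is one of the codes of its level -/
  view : {i : Lvl n} → U i → Code toBase i.val
  /-- an element of a code is one of the elements that this code has -/
  elView : {i : Lvl n} → (A : U i) → El A → ElCode (El (unk i)) (view A)
  /-- the unknown element of the unknown type -/
  unkTop : (i : Lvl n) → El (unk i)
  /-- injections into the unknown type -/
  unkInj : (i : Lvl n) → (h : Head n i.val) → ElTy (germ toBase h) → El (unk i)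

/-- The unknown type of level `i`. -/
def Hier.str {n : ℕ} (H : Hier n) (i : Lvl n) : UnkStr H.toBase i.val where
  X := H.El (H.unk i)
  err := H.unkErr i
  top := H.unkTop i
  inj := H.unkInj i

/-! Adding level `n` to the levels `< n`; everything is unchanged on the levels `< n`. -/

def extU {n : ℕ} (H : Hier n) : Lvl (n + 1) → Type
  | .last => Code H.toBase n
  | .prev i => H.U i

def extEl {n : ℕ} (H : Hier n) : {i : Lvl (n + 1)} → extU H i → Type
  | .last, A => ElCode (unkStr H.toBase).X A
  | .prev _, A => H.El A

def extLe {n : ℕ} (H : Hier n) : {i : Lvl (n + 1)} → (A : extU H i) →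
    extEl H A → extEl H A → Prop
  | .last, A => leCode (unkStr H.toBase) A
  | .prev _, A => H.le A

def extPrec {n : ℕ} (H : Hier n) : {i j : Lvl (n + 1)} → extU H i → extU H j → Type
  | .last, .last, A, B => PrecCode A B
  | .prev _, .last, A, B => PrecCode (H.view A) B
  | .last, .prev _, _, _ => Empty
  | .prev _, .prev _, A, B => H.Prec A B

def extRel {n : ℕ} (H : Hier n) : {i j : Lvl (n + 1)} → {A : extU H i} → {B : extU H j} →
    extPrec H A B → extEl H A → extEl H B → Prop
  | .last, .last, _, _, d, a, b => RelCode (unkStr H.toBase) (unkStr H.toBase) d a b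
  | .prev i, .last, A, _, d, a, b =>
      RelCode (H.str i) (unkStr H.toBase) d (H.elView A a) b
  | .last, .prev _, _, _, d, _, _ => d.elim
  | .prev _, .prev _, _, _, d, a, b => H.Rel d a b

def extBase {n : ℕ} (H : Hier n) : Base (n + 1) where
  U := extU H
  El := extEl H
  le := extLe H
  Prec := extPrec H
  Rel := extRel H
  err
    | .last => (Code.err : Code H.toBase n)
    | .prev i => H.err i
  unk
    | .last => (Code.unk : Code H.toBase n)
    | .prev i => H.unk i
  unkRefl
    | .last => (PrecCode.unk le_rfl : PrecCode (.unk : Code H.toBase n) (.unk : Code H.toBase n))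
    | .prev i => H.unkRefl i
  unkErr
    | .last => (unkStr H.toBase).err
    | .prev i => H.unkErr i

/-- A code that refers to codes of levels `< n` is a code that refers to codes of levels `< n + 1`. -/
def extTy {n : ℕ} (H : Hier n) {k : ℕ} : Ty H.toBase k → Ty (extBase H) k
  | .nat => .nat
  | .univ j h => .univ (.prev j) h
  | .pi i j h A B mon => .pi (.prev i) (.prev j) h A B mon

/-- The same for all codes. -/
def extCode {n : ℕ} (H : Hier n) {k : ℕ} : Code H.toBase k → Code (extBase H) k
  | .err => .err
  | .unk => .unk
  | .ty A => .ty (extTy H A)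

def extElTy {n : ℕ} (H : Hier n) {k : ℕ} : (A : Ty H.toBase k) → ElTy A → ElTy (extTy H A)
  | .nat, x => x
  | .univ _ _, X => X
  | .pi .., f => f

def extElCode {n : ℕ} (H : Hier n) {k : ℕ} (X : Type) : (A : Code H.toBase k) →
    ElCode X A → ElCode X (extCode H A)
  | .err, x => x
  | .unk, x => x
  | .ty A, x => extElTy H A x

/-- A head constructor of level `k ≤ n` only refers to levels `< n`. -/
def restrictHead {n : ℕ} (H : Hier n) {k : ℕ} (hk : k ≤ n) : (h : Head (n + 1) k) →
    ElTy (germ (extBase H) h) → (h : Head n k) × ElTy (germ H.toBase h)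
  | .nat, x => ⟨.nat, x⟩
  | .univ (.prev j) hj, X => ⟨.univ j hj, X⟩
  | .univ .last hj, _ => absurd (show n < k from hj) (by omega)
  | .pi (.prev i) hi, f => ⟨.pi i hi, f⟩
  | .pi .last hi, _ => absurd (show n + 1 = k from hi) (by omega)

def ext {n : ℕ} (H : Hier n) : Hier (n + 1) where
  toBase := extBase H
  view := fun {i} => match i with
    | .last => extCode H
    | .prev _ => fun A => extCode H (H.view A)
  elView := fun {i} => match i with
    | .last => fun A x => extElCode H _ A x
    | .prev _ => fun A x => extElCode H _ (H.view A) (H.elView A x)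
  unkTop
    | .last => (unkStr H.toBase).top
    | .prev i => H.unkTop i
  unkInj
    | .last, h, x =>
        let y := restrictHead H le_rfl h x
        (unkStr H.toBase).inj y.1 y.2
    | .prev i, h, x =>
        let y := restrictHead H i.val_lt.le h x
        H.unkInj i y.1 y.2

/-- No level. -/
def empty : Hier 0 where
  U := nofun
  El := fun {i} => nomatch i
  le := fun {i} => nomatch i
  Prec := fun {i} => nomatch i
  Rel := fun {i} => nomatch i
  err := nofun
  unk := nofun
  unkRefl := nofun
  unkErr := nofun
  view := fun {i} => nomatch i
  elView := fun {i} => nomatch i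
  unkTop := nofun
  unkInj := nofun

/-- The monotone universe hierarchy at the levels `< n`. -/
def hier : (n : ℕ) → Hier n
  | 0 => empty
  | n + 1 => ext (hier n)

end MonotoneModel

namespace MonotoneModel

/-! ### Orders and relations -/

/-! The proof is an induction on the number of levels. A product is made of codes of smaller levels,
so over a base that has all the properties (`Base.Good`) every claim about codes of level at most
`n` follows by case analysis on codes and derivations; no induction on codes is needed.

Embedding-projection pairs are treated as relations (`IsEpRel`): each element has a least relative
on the right and a greatest one on the left, and the embedding reflects the order. A function
between products is embedded by projecting its argument and embedding its value, and projected
dually (`exists_up_pi`, `exists_down_pi`). Composites of product relations factor through this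
embedding (`relTy_comp`).

Two facts control the unknown types. A type lies below the germ of its head at every higher level at
which germs are available (`PrecTy.le_germ`). Only a least element is related to a least element
(`IsEpRel.bot_of_bot`), so gluing the errors of the germs creates no unwanted relations. This gives
`isEpRel_relUnk`, `isEpRel_relHead` and `relCode_comp`. Derivations are unique because the two codes
determine the rule, the head fixes the germ, and the components of a product are irrelevant by
induction.

To pass to the next level, `extBase_good` reads the codes of levels at most `n` as codes over the
old base and transfers the properties along this bijection. The invariant `Hier.Good` also says that
views are bijections compatible with all relations; `ext_good` maintains this by comparing codes
over the old and over the extended base. -/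

theorem Lvl.val_inj : ∀ {n : ℕ} {i j : Lvl n}, i.val = j.val → i = j
  | _ + 1, .last, .last, _ => rfl
  | _ + 1, .last, .prev j, h => absurd (show _ = j.val from h) j.val_lt.ne'
  | _ + 1, .prev i, .last, h => absurd (show i.val = _ from h) i.val_lt.ne
  | _ + 1, .prev i, .prev j, h => congrArg _ (Lvl.val_inj (show i.val = j.val from h))

theorem Lvl.exists_val : ∀ {n k : ℕ}, k < n → ∃ i : Lvl n, i.val = k
  | n + 1, k, h => by
    rcases Nat.lt_succ_iff_lt_or_eq.1 h with h | rfl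
    · obtain ⟨i, hi⟩ := Lvl.exists_val h
      exact ⟨.prev i, hi⟩
    · exact ⟨.last, rfl⟩

theorem LNat.Le.refl : ∀ x : LNat, LNat.Le x x
  | .err => .err _
  | .unk => .unk
  | .zero => .zero
  | .succ x => .succ (LNat.Le.refl x)

theorem LNat.Le.le_unk : ∀ x : LNat, LNat.Le x .unk
  | .err => .err _
  | .unk => .unk
  | .zero => .zero_unk
  | .succ x => .succ_unk (LNat.Le.le_unk x)

theorem LNat.Le.trans {x y z : LNat} (h : LNat.Le x y) (h' : LNat.Le y z) : LNat.Le x z := by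
  induction h generalizing z with
  | err => exact .err _
  | unk => exact h'
  | zero => exact h'
  | zero_unk => cases h'; exact .zero_unk
  | succ _ ih =>
    cases h' with
    | succ h' => exact .succ (ih h')
    | succ_unk h' => exact .succ_unk (ih h')
  | succ_unk h ih => cases h'; exact .succ_unk h

theorem LNat.Le.antisymm {x y : LNat} (h : LNat.Le x y) (h' : LNat.Le y x) : x = y := by
  induction h with
  | err => cases h'; rfl
  | unk => rfl
  | zero => rfl
  | zero_unk => cases h'
  | succ _ ih => cases h' with | succ h' => rw [ih h']
  | succ_unk => cases h'

/-- Partial orders with a least and a greatest element, unbundled. -/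
structure IsBoundedOrder {α : Type} (le : α → α → Prop) : Prop where
  refl : ∀ a, le a a
  trans : ∀ {a b c}, le a b → le b c → le a c
  antisymm : ∀ {a b}, le a b → le b a → a = b
  bot : ∃ a, ∀ x, le a x
  top : ∃ a, ∀ x, le x a

/-- A relational formulation of embedding-projection pairs. -/
structure IsEpRel {α β : Type} (leA : α → α → Prop) (leB : β → β → Prop)
    (d : α → β → Prop) : Prop where
  closed : ∀ {a' a b b'}, leA a' a → d a b → leB b b' → d a' b'
  up : ∀ a, ∃ b, d a b ∧ ∀ b', d a b' → leB b b'
  down : ∀ b, ∃ a, d a b ∧ ∀ a', d a' b → leA a' a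
  reflect : ∀ {a a'}, (∀ b, d a b → d a' b) → leA a' a

section

variable {α β : Type} {leA : α → α → Prop} {leB : β → β → Prop} {d : α → β → Prop}

theorem IsEpRel.isEpPair (hd : IsEpRel leA leB d) (hA : IsBoundedOrder leA)
    (hB : IsBoundedOrder leB) : IsEpPair leA leB d := by
  choose up hu hu' using hd.up
  choose down hw hw' using hd.down
  refine ⟨fun _ _ _ _ h h' h'' => hd.closed h h' h'', up, down, fun a b => ⟨fun h => ?_, hu' a b⟩,
    fun a b => ⟨hw' b a, fun h => hd.closed h (hw b) (hB.refl b)⟩, fun a => hA.antisymm ?_ ?_⟩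
  · exact hd.closed (hA.refl a) (hu a) h
  · exact hd.reflect fun b hb => hd.closed (hA.refl _) (hw _) (hu' _ _ hb)
  · exact hw' _ _ (hu a)

theorem IsEpRel.bot_left (hd : IsEpRel leA leB d) (hB : IsBoundedOrder leB) {a : α}
    (ha : ∀ x, leA a x) (b : β) : d a b := by
  obtain ⟨a', h, -⟩ := hd.down b
  exact hd.closed (ha a') h (hB.refl b)

theorem IsEpRel.top_right (hd : IsEpRel leA leB d) (hA : IsBoundedOrder leA) {b : β}
    (hb : ∀ x, leB x b) (a : α) : d a b := by
  obtain ⟨b', h, -⟩ := hd.up a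
  exact hd.closed (hA.refl a) h (hb b')

/-- If `b` is least, closure relates `a` to every element of the codomain, so the reflection
property puts `a` below everything. This is what makes errors of germs come only from errors. -/
theorem IsEpRel.bot_of_bot (hd : IsEpRel leA leB d) (hA : IsBoundedOrder leA) {a : α} {b : β}
    (h : d a b) (hb : ∀ x, leB b x) (x : α) : leA a x :=
  hd.reflect fun _ _ => hd.closed (hA.refl a) h (hb _)

/-- Invariance under bijections. -/
theorem IsBoundedOrder.of_bijective {f : α → β} (hf : f.Bijective) (hB : IsBoundedOrder leB)
    (h : ∀ a b, leA a b ↔ leB (f a) (f b)) : IsBoundedOrder leA where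
  refl a := (h _ _).2 (hB.refl _)
  trans h₁ h₂ := (h _ _).2 (hB.trans ((h _ _).1 h₁) ((h _ _).1 h₂))
  antisymm h₁ h₂ := hf.1 (hB.antisymm ((h _ _).1 h₁) ((h _ _).1 h₂))
  bot := by
    obtain ⟨b, hb⟩ := hB.bot
    obtain ⟨a, rfl⟩ := hf.2 b
    exact ⟨a, fun x => (h _ _).2 (hb _)⟩
  top := by
    obtain ⟨b, hb⟩ := hB.top
    obtain ⟨a, rfl⟩ := hf.2 b
    exact ⟨a, fun x => (h _ _).2 (hb _)⟩

theorem IsEpRel.of_bijective {α' β' : Type} {leA' : α' → α' → Prop} {leB' : β' → β' → Prop}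
    {d' : α' → β' → Prop} (hd : IsEpRel leA leB d) {f : α' → α} {g : β' → β}
    (hf : f.Bijective) (hg : g.Bijective) (hA : ∀ a b, leA' a b ↔ leA (f a) (f b))
    (hB : ∀ a b, leB' a b ↔ leB (g a) (g b)) (h : ∀ a b, d' a b ↔ d (f a) (g b)) :
    IsEpRel leA' leB' d' where
  closed h₁ h₂ h₃ := (h _ _).2 (hd.closed ((hA _ _).1 h₁) ((h _ _).1 h₂) ((hB _ _).1 h₃))
  up a := by
    obtain ⟨b, h₁, h₂⟩ := hd.up (f a)
    obtain ⟨b, rfl⟩ := hg.2 b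
    exact ⟨b, (h _ _).2 h₁, fun b' hb => (hB _ _).2 (h₂ _ ((h _ _).1 hb))⟩
  down b := by
    obtain ⟨a, h₁, h₂⟩ := hd.down (g b)
    obtain ⟨a, rfl⟩ := hf.2 a
    exact ⟨a, (h _ _).2 h₁, fun a' ha => (hA _ _).2 (h₂ _ ((h _ _).1 ha))⟩
  reflect {a a'} hab := (hA _ _).2 <| hd.reflect fun b hb => by
    obtain ⟨b, rfl⟩ := hg.2 b
    exact (h _ _).1 (hab b ((h _ _).2 hb))

/-- The order of a partial order is an embedding-projection pair. -/
theorem IsBoundedOrder.isEpRel (hA : IsBoundedOrder leA) : IsEpRel leA leA leA where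
  closed h₁ h₂ h₃ := hA.trans (hA.trans h₁ h₂) h₃
  up a := ⟨a, hA.refl a, fun _ h => h⟩
  down a := ⟨a, hA.refl a, fun _ h => h⟩
  reflect h := h _ (hA.refl _)

end

theorem isBoundedOrder_lnat : IsBoundedOrder LNat.Le where
  refl := LNat.Le.refl
  trans := LNat.Le.trans
  antisymm := LNat.Le.antisymm
  bot := ⟨.err, .err⟩
  top := ⟨.unk, LNat.Le.le_unk⟩

/-- The properties of a universe hierarchy. -/
structure Base.Good {n : ℕ} (P : Base n) : Prop where
  level : ∀ {i j} {A : P.U i} {B : P.U j}, P.Prec A B → i.val ≤ j.val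
  refl : ∀ {i} (A : P.U i), Nonempty (P.Prec A A)
  trans : ∀ {i j k} {A : P.U i} {B : P.U j} {C : P.U k}, P.Prec A B → P.Prec B C →
    Nonempty (P.Prec A C)
  antisymm : ∀ {i} {A B : P.U i}, P.Prec A B → P.Prec B A → A = B
  irrel : ∀ {i j} {A : P.U i} {B : P.U j} (d d' : P.Prec A B), d = d'
  err_le : ∀ {i j : Lvl n}, i.val ≤ j.val → ∀ A : P.U j, Nonempty (P.Prec (P.err i) A)
  le_unk : ∀ {i j : Lvl n}, i.val ≤ j.val → ∀ A : P.U i, Nonempty (P.Prec A (P.unk j))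
  order : ∀ {i} (A : P.U i), IsBoundedOrder (P.le A)
  unkErr_le : ∀ i x, P.le (P.unk i) (P.unkErr i) x
  ep : ∀ {i j} {A : P.U i} {B : P.U j} (d : P.Prec A B), IsEpRel (P.le A) (P.le B) (P.Rel d)
  rel_self : ∀ {i} {A : P.U i} (d : P.Prec A A) {a a'}, P.Rel d a a' ↔ P.le A a a'
  rel_comp : ∀ {i j k} {A : P.U i} {B : P.U j} {C : P.U k} (d : P.Prec A B) (e : P.Prec B C)
    (f : P.Prec A C) {a c}, P.Rel f a c ↔ ∃ b, P.Rel d a b ∧ P.Rel e b c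

/-! ### Types -/

section

variable {n : ℕ} {P : Base n} {k m l : ℕ}

theorem PrecTy.level {A : Ty P k} {B : Ty P m} (d : PrecTy A B) : k ≤ m := by
  cases d <;> assumption

theorem PrecTy.hd_eq {A : Ty P k} {B : Ty P m} (d : PrecTy A B) : A.hd = B.hd := by
  cases d <;> rfl

variable (hP : P.Good)
include hP

theorem Base.Good.rel_trans {i j k} {A : P.U i} {B : P.U j} {C : P.U k} (d : P.Prec A B)
    (e : P.Prec B C) (f : P.Prec A C) {a b c} (h : P.Rel d a b) (h' : P.Rel e b c) :
    P.Rel f a c :=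
  (hP.rel_comp d e f).2 ⟨_, h, h'⟩

/-- A square of codes: a relation along one side factors through the other side. -/
theorem Base.Good.rel_square {i j k l} {A : P.U i} {B : P.U j} {C : P.U k} {D : P.U l}
    (d : P.Prec A B) (e : P.Prec B D) (f : P.Prec A C) (g : P.Prec C D) {a b c}
    (h : P.Rel d a b) (h' : P.Rel e b c) : ∃ b', P.Rel f a b' ∧ P.Rel g b' c := by
  obtain ⟨s⟩ := hP.trans d e
  exact (hP.rel_comp f g s).1 (hP.rel_trans d e s h h')

theorem PrecTy.irrel {A : Ty P k} {B : Ty P m} (d d' : PrecTy A B) : d = d' := by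
  cases d with
  | nat => cases d'; rfl
  | univ => cases d'; rfl
  | pi hkm dom cod =>
    cases d' with
    | pi _ dom' cod' =>
      -- The type of the codomain family depends on the domain derivation, which is therefore
      -- identified first.
      obtain rfl := hP.irrel dom dom'
      congr 1
      funext a a' r
      exact hP.irrel _ _

theorem PrecTy.refl (A : Ty P k) : Nonempty (PrecTy A A) := by
  cases A with
  | nat => exact ⟨.nat le_rfl⟩
  | univ j h => exact ⟨.univ le_rfl j h h⟩
  | pi i j h A B mon =>
    obtain ⟨d⟩ := hP.refl A
    -- The monotonicity data of the family is exactly the codomain part of reflexivity.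
    exact ⟨.pi le_rfl d fun a a' r => mon a a' ((hP.rel_self d).1 r)⟩

theorem PrecTy.trans {A : Ty P k} {B : Ty P m} {C : Ty P l} (d : PrecTy A B) (e : PrecTy B C) :
    Nonempty (PrecTy A C) := by
  cases d with
  | nat hkm => cases e with | nat h => exact ⟨.nat (hkm.trans h)⟩
  | univ hkm j h h' => cases e with | univ hml _ _ h'' => exact ⟨.univ (hkm.trans hml) j h h''⟩
  | pi hkm dom cod =>
    cases e with
    | pi hml dom' cod' =>
      obtain ⟨dom''⟩ := hP.trans dom dom'
      refine ⟨.pi (hkm.trans hml) dom'' fun a a' r => Nonempty.some ?_⟩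
      -- A middle argument is needed to compose the codomain derivations.
      obtain ⟨b, h, h'⟩ := (hP.rel_comp dom dom' dom'').1 r
      exact hP.trans (cod _ _ h) (cod' _ _ h')

theorem PrecTy.antisymm {A B : Ty P k} (d : PrecTy A B) (e : PrecTy B A) : A = B := by
  cases d with
  | nat => rfl
  | univ => rfl
  | @pi _ i j i' j' h h' A B mon A' B' mon' dom cod =>
    cases e with
    | pi _ dom' cod' =>
      obtain rfl := Lvl.val_inj (le_antisymm (hP.level dom) (hP.level dom'))
      obtain rfl := hP.antisymm dom dom'
      have hr (a) : P.Rel dom a a := (hP.rel_self dom).2 ((hP.order A).refl a)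
      have hr' (a) : P.Rel dom' a a := (hP.rel_self dom').2 ((hP.order A).refl a)
      -- The levels of the codomains can only be compared at an argument; the least element provides
      -- one.
      obtain ⟨a₀, -⟩ := (hP.order A).bot
      obtain rfl := Lvl.val_inj (le_antisymm (hP.level (cod _ _ (hr a₀)))
        (hP.level (cod' _ _ (hr' a₀))))
      obtain rfl : B = B' := funext fun a => hP.antisymm (cod _ _ (hr a)) (cod' _ _ (hr' a))
      congr 1
      funext a a' r
      exact hP.irrel _ _

theorem isBoundedOrder_univ (i : Lvl n) :
    IsBoundedOrder fun X Y : P.U i => Nonempty (P.Prec X Y) where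
  refl := hP.refl
  trans := fun ⟨d⟩ ⟨e⟩ => hP.trans d e
  antisymm := fun ⟨d⟩ ⟨e⟩ => hP.antisymm d e
  bot := ⟨P.err i, hP.err_le le_rfl⟩
  top := ⟨P.unk i, hP.le_unk le_rfl⟩

theorem isBoundedOrder_leTy (A : Ty P k) : IsBoundedOrder (leTy A) := by
  cases A with
  | nat => exact isBoundedOrder_lnat
  | univ i => exact isBoundedOrder_univ hP i
  | pi i j h A B mon =>
    refine ⟨fun f a => (hP.order _).refl _, fun h h' a => (hP.order _).trans (h a) (h' a),
      fun h h' => Subtype.ext (funext fun a => (hP.order _).antisymm (h a) (h' a)), ?_, ?_⟩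
    · choose b hb using fun a => (hP.order (B a)).bot
      -- The family of least elements is monotone, as a least element is related to everything.
      exact ⟨⟨b, fun a a' r => (hP.ep _).bot_left (hP.order _) (hb a) _⟩, fun f a => hb a _⟩
    · choose b hb using fun a => (hP.order (B a)).top
      exact ⟨⟨b, fun a a' r => (hP.ep _).top_right (hP.order _) (hb a') _⟩, fun f a => hb a _⟩

theorem relTy_self {A : Ty P k} (d : PrecTy A A) {x y : ElTy A} : RelTy d x y ↔ leTy A x y := by
  cases d with
  | nat => rfl
  | univ => rfl
  | @pi _ i j _ _ _ _ A B mon _ _ _ dom cod =>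
    refine ⟨fun h a => ?_, fun h a a' r => ?_⟩
    · have r := (hP.rel_self dom).2 ((hP.order A).refl a)
      exact (hP.rel_self (cod a a r)).1 (h a a r)
    · have r' := (hP.rel_self dom).1 r
      rw [hP.irrel (cod a a' r) (mon a a' r')]
      exact (hP.ep _).closed (h a) (y.2 a a' r') ((hP.order _).refl _)

/-- The embedding of a product, which is computed by projecting arguments and embedding values. -/
theorem Base.Good.exists_up_pi {i j i' j'} {A : P.U i} {B : P.El A → P.U j} {mon}
    {A' : P.U i'} {B' : P.El A' → P.U j'} {mon'} (dom : P.Prec A A')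
    (cod : ∀ a a', P.Rel dom a a' → P.Prec (B a) (B' a')) (f : P.PiMon A B mon) :
    ∃ g : P.PiMon A' B' mon',
      (∀ a a' (r : P.Rel dom a a'), P.Rel (cod a a' r) (f.1 a) (g.1 a')) ∧
      ∀ a', ∃ a, ∃ r : P.Rel dom a a', (∀ a₁, P.Rel dom a₁ a' → P.le A a₁ a) ∧
        ∀ y, P.Rel (cod a a' r) (f.1 a) y → P.le (B' a') (g.1 a') y := by
  choose dn hdn hdn' using (hP.ep dom).down
  choose up hup hup' using fun a' => (hP.ep (cod _ _ (hdn a'))).up (f.1 (dn a'))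
  refine ⟨⟨up, fun a a' r => ?_⟩, fun a a' r => ?_, fun a' => ⟨dn a', hdn a', hdn' a', hup' a'⟩⟩
  · have r' : P.le A (dn a) (dn a') :=
      hdn' _ _ ((hP.ep dom).closed ((hP.order A).refl _) (hdn a) r)
    -- The square has corners `B (dn a)`, `B (dn a')`, `B' a` and `B' a'`. Passing through `B' a`
    -- yields a `y` above the least relative `up a`.
    obtain ⟨y, h₁, h₂⟩ := hP.rel_square _ (cod _ _ (hdn a')) (cod _ _ (hdn a)) (mon' a a' r)
      (f.2 _ _ r') (hup a')
    exact (hP.ep _).closed (hup' _ _ h₁) h₂ ((hP.order _).refl _)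
  · exact hP.rel_trans _ _ _ (f.2 _ _ (hdn' _ _ r)) (hup a')

/-- Dual to the embedding: the argument is embedded, `g` is applied, and the value is projected. -/
theorem Base.Good.exists_down_pi {i j i' j'} {A : P.U i} {B : P.El A → P.U j} {mon}
    {A' : P.U i'} {B' : P.El A' → P.U j'} {mon'} (dom : P.Prec A A')
    (cod : ∀ a a', P.Rel dom a a' → P.Prec (B a) (B' a')) (g : P.PiMon A' B' mon') :
    ∃ f : P.PiMon A B mon,
      (∀ a a' (r : P.Rel dom a a'), P.Rel (cod a a' r) (f.1 a) (g.1 a')) ∧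
      ∀ a, ∃ a', ∃ r : P.Rel dom a a',
        ∀ x, P.Rel (cod a a' r) x (g.1 a') → P.le (B a) x (f.1 a) := by
  choose up hup hup' using (hP.ep dom).up
  choose dn hdn hdn' using fun a => (hP.ep (cod _ _ (hup a))).down (g.1 (up a))
  refine ⟨⟨dn, fun a a' r => ?_⟩, fun a a' r => ?_, fun a => ⟨up a, hup a, hdn' a⟩⟩
  · have r' : P.le A' (up a) (up a') :=
      hup' _ _ ((hP.ep dom).closed r (hup a') ((hP.order _).refl _))
    obtain ⟨y, h₁, h₂⟩ := hP.rel_square (cod _ _ (hup a)) _ (mon a a' r) (cod _ _ (hup a'))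
      (hdn a) (g.2 _ _ r')
    exact (hP.ep _).closed ((hP.order _).refl _) h₁ (hdn' _ _ h₂)
  · exact hP.rel_trans _ _ _ (hdn a) (g.2 _ _ (hup' _ _ r))

theorem isEpRel_relTy {A : Ty P k} {B : Ty P m} (d : PrecTy A B) :
    IsEpRel (leTy A) (leTy B) (RelTy d) := by
  cases d with
  | nat => exact isBoundedOrder_lnat.isEpRel
  | univ _ i => exact (isBoundedOrder_univ hP i).isEpRel
  | pi _ dom cod =>
    refine ⟨fun {f' f g g'} h h' h'' a a' r => (hP.ep _).closed (h a) (h' a a' r) (h'' a'),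
      fun f => ?_, fun g => ?_, fun {f f'} h a => ?_⟩
    · obtain ⟨g, h, hg⟩ := hP.exists_up_pi dom cod f
      refine ⟨g, h, fun g' h' a' => ?_⟩
      obtain ⟨a, r, -, ha⟩ := hg a'
      exact ha _ (h' _ _ r)
    · obtain ⟨f, h, hf⟩ := hP.exists_down_pi dom cod g
      refine ⟨f, h, fun f' h' a => ?_⟩
      obtain ⟨a', r, ha⟩ := hf a
      exact ha _ (h' _ _ r)
    · obtain ⟨g, hfg, hg⟩ := hP.exists_up_pi dom cod f
      obtain ⟨a', r, ha'⟩ := (hP.ep dom).up a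
      obtain ⟨a₁, r₁, h₁, h₂⟩ := hg a'
      -- The argument `a₁` is the projection of the embedding of `a`, hence `a` itself. So at `a'`
      -- the embedding of `f` is the embedding of `f a`, and reflection in the codomain applies.
      obtain rfl : a₁ = a := (hP.order _).antisymm
        ((hP.ep dom).reflect fun b hb =>
          (hP.ep dom).closed ((hP.order _).refl _) r₁ (ha' _ hb))
        (h₁ _ r)
      exact (hP.ep _).reflect fun b hb =>
        (hP.ep _).closed ((hP.order _).refl _) (h g hfg _ _ r₁) (h₂ _ hb)

theorem relTy_comp {A : Ty P k} {B : Ty P m} {C : Ty P l} (d : PrecTy A B) (e : PrecTy B C)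
    (f : PrecTy A C) {x : ElTy A} {z : ElTy C} :
    RelTy f x z ↔ ∃ y, RelTy d x y ∧ RelTy e y z := by
  cases d with
  | nat =>
    cases e
    cases f
    exact ⟨fun h => ⟨x, LNat.Le.refl x, h⟩, fun ⟨y, h, h'⟩ => LNat.Le.trans h h'⟩
  | univ _ i =>
    cases e
    cases f
    exact ⟨fun h => ⟨x, hP.refl x, h⟩, fun ⟨y, h, h'⟩ => (isBoundedOrder_univ hP i).trans h h'⟩
  | pi _ dom cod =>
    cases e with
    | pi _ dom' cod' =>
      cases f with
      | pi _ dom'' cod'' =>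
        refine ⟨fun h => ?_, fun ⟨y, h, h'⟩ a a'' r => ?_⟩
        -- The middle function is the embedding of `x`; its value at `a'` lies below any
        -- intermediate value that `rel_comp` provides at the projected argument.
        · obtain ⟨y, hxy, hy⟩ := hP.exists_up_pi dom cod x
          refine ⟨y, hxy, fun a' a'' r' => ?_⟩
          obtain ⟨a, r, -, ha⟩ := hy a'
          have r'' := hP.rel_trans dom dom' dom'' r r'
          obtain ⟨b, h₁, h₂⟩ := (hP.rel_comp (cod _ _ r) (cod' _ _ r') (cod'' _ _ r'')).1
            (h _ _ r'')
          exact (hP.ep _).closed (ha _ h₁) h₂ ((hP.order _).refl _)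
        · obtain ⟨a', r₁, r₂⟩ := (hP.rel_comp dom dom' dom'').1 r
          exact hP.rel_trans _ _ _ (h _ _ r₁) (h' _ _ r₂)

end

/-! ### Heads and germs -/

section

variable {n : ℕ} {P : Base n} {k m l : ℕ}

theorem Head.hd_inj : ∀ {h h' : Head n k}, h.hd = h'.hd → h = h'
  | .nat, .nat, _ => rfl
  | .univ j _, .univ j' _, e => by
    obtain rfl : j = j' := Lvl.val_inj (by simpa [Head.hd] using e)
    rfl
  | .pi i h, .pi i' h', _ => by
    obtain rfl : i = i' := Lvl.val_inj (by omega)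
    rfl

theorem germ_hd (h : Head n k) : (germ P h).hd = h.hd := by
  cases h <;> rfl

theorem Ty.exists_head (A : Ty P k) (hkm : k ≤ m) (hm : m ≤ n) : ∃ h : Head n m, A.hd = h.hd := by
  cases A with
  | nat => exact ⟨.nat, rfl⟩
  | univ j h => exact ⟨.univ j (h.trans_le hkm), rfl⟩
  | pi i j h =>
    -- A product has positive level, so `m ≥ 1`, and `m ≤ n` puts `m - 1` among the levels of the
    -- base.
    obtain ⟨i', hi'⟩ : ∃ i' : Lvl n, i'.val = m - 1 := Lvl.exists_val (by omega)
    exact ⟨.pi i' (by omega), rfl⟩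

theorem Head.exists_head (h : Head n k) (hkm : k ≤ m) (hm : m ≤ n) :
    ∃ h' : Head n m, h.hd = h'.hd := by
  cases h with
  | nat => exact ⟨.nat, rfl⟩
  | univ j h => exact ⟨.univ j (h.trans_le hkm), rfl⟩
  | pi i h =>
    obtain ⟨i', hi'⟩ : ∃ i' : Lvl n, i'.val = m - 1 := Lvl.exists_val (by omega)
    exact ⟨.pi i' (by omega), rfl⟩

end

/-- The expected description of the elements of the unknown type. -/
structure UnkStr.Good {n : ℕ} {P : Base n} {k : ℕ} (S : UnkStr P k) : Prop where
  exhaust : ∀ z, z = S.err ∨ z = S.top ∨ ∃ h x, z = S.inj h x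
  top_ne_err : S.top ≠ S.err
  inj_ne_top : ∀ {h x}, S.inj h x ≠ S.top
  inj_eq_err : ∀ {h x}, S.inj h x = S.err ↔ IsErr P h x
  inj_inj : ∀ {h x h' x'}, S.inj h x = S.inj h' x' → IsErr P h x ∧ IsErr P h' x' ∨
    (⟨h, x⟩ : (h : Head n k) × ElTy (germ P h)) = ⟨h', x'⟩

section

open Classical in
/-- The normal form of an extended pair. -/
noncomputable def PreUnk.normalize {n : ℕ} {P : Base n} : PreUnk P → PreUnk P
  | .err => .err
  | .top => .top
  | .inj h x => if IsErr P h x then .err else .inj h x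

/-- Glued pairs have the same normal form, so `PreUnk.normalize` is defined on the quotient, and
equal classes have equal normal forms. -/
theorem unkStr_good {n : ℕ} (P : Base n) : (unkStr P).Good := by
  have key {y z : PreUnk P} (h : Quot.mk (PreUnk.Glue P) y = Quot.mk (PreUnk.Glue P) z) :
      y.normalize = z.normalize := by
    refine congrArg (Quot.lift PreUnk.normalize ?_) h
    rintro _ _ ⟨h, x, hx⟩
    simp [PreUnk.normalize, hx]
  refine ⟨fun z => ?_, fun h => ?_, fun {h x} e => ?_, fun {h x} => ⟨fun e => ?_, fun e => ?_⟩,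
    fun {h x h' x'} e => ?_⟩
  · induction z using Quot.ind with
    | mk z =>
      cases z with
      | err => exact .inl rfl
      | top => exact .inr (.inl rfl)
      | inj h x => exact .inr (.inr ⟨h, x, rfl⟩)
  · simpa [PreUnk.normalize] using key h
  · have := key e
    simp only [PreUnk.normalize] at this
    split at this <;> simp at this
  · have := key e
    simp only [PreUnk.normalize] at this
    split at this
    · assumption
    · simp at this
  · exact Quot.sound (.inj_err h x e)
  · have := key e
    simp only [PreUnk.normalize] at this
    split at this <;> split at this
    · left; constructor <;> assumption
    · simp at this
    · simp at this
    · right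
      cases this
      rfl

end

/-! ### The unknown type -/

section

variable {n : ℕ} {P : Base n} {k m l : ℕ} (hP : P.Good)
include hP

/-- For a product, domain and codomains have levels at most `k - 1 ≤ m - 1`, so they lie below the
unknown type of level `m - 1`; this uses `le_unk` across levels. -/
theorem PrecTy.le_germ {A : Ty P k} (hkm : k ≤ m) {h : Head n m} (hA : A.hd = h.hd) :
    Nonempty (PrecTy A (germ P h)) := by
  cases A with
  | nat => cases h <;> simp [Ty.hd, Head.hd] at hA; exact ⟨.nat hkm⟩
  | univ j hj =>
    cases h with
    | univ j' hj' =>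
      obtain rfl : j = j' := Lvl.val_inj (by simpa [Ty.hd, Head.hd] using hA)
      exact ⟨.univ hkm _ _ _⟩
    | _ => simp [Ty.hd, Head.hd] at hA
  | pi i j hij A B mon =>
    cases h with
    | pi i' hi' =>
      obtain ⟨dom⟩ := hP.le_unk (j := i') (by omega) A
      exact ⟨.pi hkm dom fun a _ _ => (hP.le_unk (by omega) (B a)).some⟩
    | _ => simp [Ty.hd, Head.hd] at hA

theorem PrecTy.germ_le_germ (hkm : k ≤ m) {h : Head n k} {h' : Head n m} (hh : h.hd = h'.hd) :
    Nonempty (PrecTy (germ P h) (germ P h')) :=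
  PrecTy.le_germ hP hkm ((germ_hd h).trans hh)

/-- Being an error becomes an order-theoretic notion, to which the facts on least elements in
ep-pairs apply. -/
theorem isErr_iff {h : Head n k} {x : ElTy (germ P h)} :
    IsErr P h x ↔ ∀ y, leTy (germ P h) x y := by
  cases h with
  | nat =>
    refine ⟨?_, fun h => ?_⟩
    · rintro rfl
      exact LNat.Le.err
    · exact LNat.Le.antisymm (h LNat.err) (.err _)
  | univ j =>
    refine ⟨?_, fun h => ?_⟩
    · rintro rfl
      exact hP.err_le le_rfl
    · exact (isBoundedOrder_univ hP j).antisymm (h (P.err j)) (hP.err_le le_rfl x)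
  | pi i =>
    refine ⟨fun h y a => ?_, fun h a => ?_⟩
    · have := hP.unkErr_le i (y.1 a)
      rwa [← h a] at this
    -- A least function is compared with the constant error function.
    · exact (hP.order _).antisymm (h ⟨fun _ => P.unkErr i, fun _ _ _ =>
        (hP.rel_self _).2 ((hP.order _).refl _)⟩ a) (hP.unkErr_le i _)

theorem IsErr.of_relTy {h : Head n k} {h' : Head n m} {d : PrecTy (germ P h) (germ P h')} {x x'}
    (hx' : IsErr P h' x') (r : RelTy d x x') : IsErr P h x :=
  (isErr_iff hP).2 fun y => (isEpRel_relTy hP d).bot_of_bot (isBoundedOrder_leTy hP _) r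
    ((isErr_iff hP).1 hx') y

theorem exists_isErr (h : Head n k) : ∃ x, IsErr P h x :=
  let ⟨x, hx⟩ := (isBoundedOrder_leTy hP (germ P h)).bot
  ⟨x, (isErr_iff hP).2 hx⟩

theorem relUnk_self {S : UnkStr P k} {z w : S.X} (hS : S.Good) :
    RelUnk S S z w ↔ UnkLe S z w := by
  refine ⟨fun h => ?_, fun h => ?_⟩
  · cases h with
    | err => exact .err _
    | top =>
      obtain rfl | rfl | ⟨h, x, rfl⟩ := hS.exhaust z
      · exact .err _
      · exact .top
      · exact .inj_top _ _
    | inj h h' hh d r =>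
      obtain rfl := Head.hd_inj hh
      exact .inj h ((relTy_self hP d).1 r)
  · cases h with
    | err => exact .err _
    | top => exact .top _
    | inj h r =>
      obtain ⟨d⟩ := PrecTy.refl hP (germ P h)
      exact .inj h h rfl d ((relTy_self hP d).2 r)
    | inj_top => exact .top _

section

variable {S : UnkStr P k} {S' : UnkStr P m} {S'' : UnkStr P l}

theorem RelUnk.eq_err (hS : S.Good) (hS' : S'.Good) {z : S.X} (h : RelUnk S S' z S'.err) :
    z = S.err := by
  generalize hw : S'.err = w at h
  cases h with
  | err => rfl
  | top => exact absurd hw.symm hS'.top_ne_err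
  | inj h h' hh d r => exact hS.inj_eq_err.2 ((hS'.inj_eq_err.1 hw.symm).of_relTy hP r)

omit hP in
theorem RelUnk.eq_top (hS : S.Good) {w : S'.X} (h : RelUnk S S' S.top w) : w = S'.top := by
  generalize hz : S.top = z at h
  cases h with
  | err => exact absurd hz hS.top_ne_err
  | top => rfl
  | inj h h' hh d r => exact absurd hz.symm hS.inj_ne_top

omit hP in
-- Inversion up to gluing: an error pair may equal a pair with another head, or the error, so
-- nothing is known of `w` in the first alternative.
theorem RelUnk.of_inj (hS : S.Good) {h : Head n k} {x : ElTy (germ P h)} {w : S'.X}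
    (hw : RelUnk S S' (S.inj h x) w) : IsErr P h x ∨ w = S'.top ∨
      ∃ (h' : Head n m) (_ : h.hd = h'.hd) (d : PrecTy (germ P h) (germ P h')) (x' : _),
        w = S'.inj h' x' ∧ RelTy d x x' := by
  generalize hz : S.inj h x = z at hw
  cases hw with
  | err => exact .inl (hS.inj_eq_err.1 hz)
  | top => exact .inr (.inl rfl)
  | inj h₁ h' hh d r =>
    obtain ⟨hx, -⟩ | e := hS.inj_inj hz
    · exact .inl hx
    · cases e
      exact .inr (.inr ⟨h', hh, d, _, rfl, r⟩)

theorem RelUnk.of_inj_inj (hS : S.Good) (hS' : S'.Good) {h : Head n k} {x : ElTy (germ P h)}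
    {h' : Head n m} {x' : ElTy (germ P h')} (r : RelUnk S S' (S.inj h x) (S'.inj h' x')) :
    IsErr P h x ∨ h.hd = h'.hd ∧ ∃ d : PrecTy (germ P h) (germ P h'), RelTy d x x' := by
  obtain hx | e | ⟨h₁, hh, d, x₁, e, r⟩ := r.of_inj hS
  · exact .inl hx
  · exact absurd e hS'.inj_ne_top
  · obtain ⟨-, hx⟩ | e := hS'.inj_inj e
    · exact .inl (hx.of_relTy hP r)
    · cases e
      exact .inr ⟨hh, d, r⟩

theorem RelUnk.trans (hS : S.Good) (hS' : S'.Good) {z : S.X} {w : S'.X} {v : S''.X}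
    (h₁ : RelUnk S S' z w) (h₂ : RelUnk S' S'' w v) : RelUnk S S'' z v := by
  cases h₁ with
  | err => exact .err _
  | top => rw [h₂.eq_top hS']; exact .top _
  | inj h h' hh d r =>
    obtain hx | rfl | ⟨h'', hh', d', x'', rfl, r'⟩ := h₂.of_inj hS'
    · rw [hS.inj_eq_err.2 (hx.of_relTy hP r)]
      exact .err _
    · exact .top _
    · obtain ⟨d''⟩ := d.trans hP d'
      exact .inj _ _ (hh.trans hh') d'' ((relTy_comp hP d d' d'').2 ⟨_, r, r'⟩)

theorem UnkLe.of_inj (hS : S.Good) {h : Head n k} {x : ElTy (germ P h)} {w : S.X}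
    (hw : UnkLe S (S.inj h x) w) : IsErr P h x ∨ w = S.top ∨
      ∃ x', w = S.inj h x' ∧ leTy (germ P h) x x' := by
  obtain hx | e | ⟨h', hh, d, x', e, r⟩ := ((relUnk_self hP hS).2 hw).of_inj hS
  · exact .inl hx
  · exact .inr (.inl e)
  · obtain rfl := Head.hd_inj hh
    exact .inr (.inr ⟨x', e, (relTy_self hP d).1 r⟩)

theorem UnkLe.of_inj_inj (hS : S.Good) {h : Head n k} {x : ElTy (germ P h)}
    {h' : Head n k} {x' : ElTy (germ P h')} (r : UnkLe S (S.inj h x) (S.inj h' x')) :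
    IsErr P h x ∨ ∃ y, (⟨h', x'⟩ : (h : Head n k) × ElTy (germ P h)) = ⟨h, y⟩ ∧
      leTy (germ P h) x y := by
  obtain hx | ⟨hh, d, r⟩ := ((relUnk_self hP hS).2 r).of_inj_inj hP hS hS
  · exact .inl hx
  · obtain rfl := Head.hd_inj hh
    exact .inr ⟨x', rfl, (relTy_self hP d).1 r⟩

theorem isBoundedOrder_unkLe (hS : S.Good) : IsBoundedOrder (UnkLe S) where
  refl z := by
    obtain rfl | rfl | ⟨h, x, rfl⟩ := hS.exhaust z
    · exact .err _
    · exact .top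
    · exact .inj h ((isBoundedOrder_leTy hP _).refl x)
  trans h h' := by
    rw [← relUnk_self hP hS] at *
    exact h.trans hP hS hS h'
  antisymm {z w} h h' := by
    obtain rfl | rfl | ⟨h₀, x, rfl⟩ := hS.exhaust z
    · rw [← relUnk_self hP hS] at h'
      exact (h'.eq_err hP hS hS).symm
    · rw [← relUnk_self hP hS] at h
      exact (h.eq_top hS).symm
    · obtain hx | rfl | ⟨x', rfl, r⟩ := h.of_inj hP hS
      · rw [hS.inj_eq_err.2 hx] at h' ⊢
        rw [← relUnk_self hP hS] at h'
        exact (h'.eq_err hP hS hS).symm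
      · rw [← relUnk_self hP hS] at h'
        exact h'.eq_top hS
      · obtain hx | ⟨y, e, r'⟩ := h'.of_inj_inj hP hS
        · rw [hS.inj_eq_err.2 hx] at h ⊢
          rw [← relUnk_self hP hS] at h
          exact h.eq_err hP hS hS
        · cases e
          rw [(isBoundedOrder_leTy hP _).antisymm r r']
  bot := ⟨S.err, .err⟩
  top := ⟨S.top, fun z => (relUnk_self hP hS).1 (.top z)⟩

theorem isEpRel_relUnk (hS : S.Good) (hS' : S'.Good) (hkm : k ≤ m) (hm : m ≤ n) :
    IsEpRel (UnkLe S) (UnkLe S') (RelUnk S S') where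
  closed h₁ h₂ h₃ := by
    rw [← relUnk_self hP ‹_›] at h₁ h₃
    exact (h₁.trans hP hS hS h₂).trans hP hS hS' h₃
  up z := by
    obtain rfl | rfl | ⟨h, x, rfl⟩ := hS.exhaust z
    · exact ⟨S'.err, .err _, fun _ _ => .err _⟩
    · refine ⟨S'.top, .top _, fun w hw => ?_⟩
      rw [hw.eq_top hS]
      exact .top
    · obtain ⟨h', hh⟩ := h.exists_head hkm hm
      obtain ⟨d⟩ := PrecTy.germ_le_germ hP hkm hh
      obtain ⟨x', r, hx'⟩ := (isEpRel_relTy hP d).up x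
      refine ⟨S'.inj h' x', .inj h h' hh d r, fun w hw => ?_⟩
      obtain hx | rfl | ⟨h₁, hh', d', x₁, rfl, r'⟩ := hw.of_inj hS
      · rw [hS'.inj_eq_err.2 ((isErr_iff hP).2 fun y => hx' _ <| (isEpRel_relTy hP d).bot_left
          (isBoundedOrder_leTy hP _) ((isErr_iff hP).1 hx) y)]
        exact .err _
      · exact .inj_top _ _
      · obtain rfl := Head.hd_inj (hh.symm.trans hh')
        obtain rfl := PrecTy.irrel hP d d'
        exact .inj _ (hx' _ r')
  down w := by
    obtain rfl | rfl | ⟨h', x', rfl⟩ := hS'.exhaust w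
    · refine ⟨S.err, .err _, fun z hz => ?_⟩
      rw [hz.eq_err hP hS hS']
      exact .err _
    · exact ⟨S.top, .top _, fun z _ => (relUnk_self hP hS).1 (.top z)⟩
    · by_cases hh : ∃ h : Head n k, h.hd = h'.hd
      · obtain ⟨h, hh⟩ := hh
        obtain ⟨d⟩ := PrecTy.germ_le_germ hP hkm hh
        obtain ⟨x, r, hx⟩ := (isEpRel_relTy hP d).down x'
        refine ⟨S.inj h x, .inj h h' hh d r, fun z hz => ?_⟩
        obtain rfl | rfl | ⟨h₁, x₁, rfl⟩ := hS.exhaust z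
        · exact .err _
        · exact absurd (hz.eq_top hS) hS'.inj_ne_top
        · obtain hx | ⟨hh', d', r'⟩ := hz.of_inj_inj hP hS hS'
          · rw [hS.inj_eq_err.2 hx]
            exact .err _
          · obtain rfl := Head.hd_inj (hh.trans hh'.symm)
            obtain rfl := PrecTy.irrel hP d d'
            exact .inj _ (hx _ r')
      -- The head is missing at the lower level (a universe of level at least `k`, or the product
      -- when `k = 0`), so the pair projects to the error.
      · refine ⟨S.err, .err _, fun z hz => ?_⟩
        obtain rfl | rfl | ⟨h₁, x₁, rfl⟩ := hS.exhaust z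
        · exact .err _
        · exact absurd (hz.eq_top hS) hS'.inj_ne_top
        · obtain hx | ⟨hh', -⟩ := hz.of_inj_inj hP hS hS'
          · rw [hS.inj_eq_err.2 hx]
            exact .err _
          · exact absurd ⟨_, hh'⟩ hh
  reflect {z z'} hz := by
    obtain rfl | rfl | ⟨h, x, rfl⟩ := hS.exhaust z
    · rw [(hz _ (.err _)).eq_err hP hS hS']
      exact .err _
    · exact (relUnk_self hP hS).1 (.top z')
    · obtain ⟨h', hh⟩ := h.exists_head hkm hm
      obtain ⟨d⟩ := PrecTy.germ_le_germ hP hkm hh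
      obtain ⟨x', r, hx'⟩ := (isEpRel_relTy hP d).up x
      have hz' := hz _ (.inj h h' hh d r)
      obtain rfl | rfl | ⟨h₁, x₁, rfl⟩ := hS.exhaust z'
      · exact .err _
      · exact absurd (hz'.eq_top hS) hS'.inj_ne_top
      · obtain hx | ⟨hh', d', r'⟩ := hz'.of_inj_inj hP hS hS'
        · rw [hS.inj_eq_err.2 hx]
          exact .err _
        · obtain rfl := Head.hd_inj (hh.trans hh'.symm)
          obtain rfl := PrecTy.irrel hP d d'
          have hd := isEpRel_relTy hP d
          have hA := isBoundedOrder_leTy hP (germ P h)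
          exact .inj _ (hd.reflect fun b hb => hd.closed (hA.refl _) r' (hx' _ hb))

theorem relUnk_comp (hS : S.Good) (hS' : S'.Good) (hkm : k ≤ m) (hml : m ≤ l) (hm : m ≤ n)
    {z : S.X} {v : S''.X} :
    RelUnk S S'' z v ↔ ∃ w, RelUnk S S' z w ∧ RelUnk S' S'' w v := by
  refine ⟨fun h => ?_, fun ⟨w, h, h'⟩ => h.trans hP hS hS' h'⟩
  cases h with
  | err => exact ⟨S'.err, .err _, .err _⟩
  | top => exact ⟨S'.top, .top _, .top _⟩
  | inj h h'' hh d r =>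
    obtain ⟨h', hh'⟩ := h.exists_head hkm hm
    obtain ⟨d₁⟩ := PrecTy.germ_le_germ hP hkm hh'
    obtain ⟨d₂⟩ := PrecTy.germ_le_germ hP hml (hh'.symm.trans hh)
    obtain ⟨x', r₁, r₂⟩ := (relTy_comp hP d₁ d₂ d).1 r
    exact ⟨S'.inj h' x', .inj _ _ hh' _ r₁, .inj _ _ (hh'.symm.trans hh) _ r₂⟩

variable {A : Ty P k} {h : Head n m} (d : PrecTy A (germ P h))

omit hP in
theorem relHead_iff {d : PrecTy A (germ P h)} {a z} :
    RelHead S' h d a z ↔ z = S'.top ∨ ∃ x, RelTy d a x ∧ UnkLe S' (S'.inj h x) z := by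
  refine ⟨fun r => ?_, ?_⟩
  · cases r with
    | inj r r' => exact .inr ⟨_, r, r'⟩
    | top => exact .inl rfl
  · rintro (rfl | ⟨x, r, r'⟩)
    · exact .top _
    · exact .inj r r'

theorem isEpRel_relHead (hS' : S'.Good) : IsEpRel (leTy A) (UnkLe S') (RelHead S' h d) := by
  have hA := isBoundedOrder_leTy hP A
  have hG := isBoundedOrder_leTy hP (germ P h)
  have hX := isBoundedOrder_unkLe hP hS'
  have hd := isEpRel_relTy hP d
  have bot_of {a x} (r : RelTy d a x) (hx : IsErr P h x) : ∀ y, leTy A a y :=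
    hd.bot_of_bot hA r ((isErr_iff hP).1 hx)
  -- No rule of `RelHead` mentions the error: a least element reaches every `z` through an error of
  -- the germ.
  have rel_bot {a} (ha : ∀ y, leTy A a y) (z) : RelHead S' h d a z := by
    obtain ⟨x, hx⟩ := exists_isErr hP h
    refine .inj (hd.bot_left hG ha x) ?_
    rw [hS'.inj_eq_err.2 hx]
    exact .err _
  refine ⟨fun {a' a z z'} h₁ h₂ h₃ => ?_, fun a => ?_, fun z => ?_, fun {a a'} r => ?_⟩
  · cases h₂ with
    | inj r r' => exact .inj (hd.closed h₁ r (hG.refl _)) (hX.trans r' h₃)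
    | top =>
      rw [((relUnk_self hP hS').2 h₃).eq_top hS']
      exact .top _
  · obtain ⟨x, r, hx⟩ := hd.up a
    refine ⟨S'.inj h x, .inj r (hX.refl _), fun z hz => ?_⟩
    obtain rfl | ⟨x', r', hz⟩ := relHead_iff.1 hz
    · exact .inj_top _ _
    · exact hX.trans (.inj _ (hx _ r')) hz
  -- The projection of `z`: through the germ for a pair with head `h`, the greatest element for `?`,
  -- and the least element for the error or a foreign head.
  · by_cases hz : ∃ x, z = S'.inj h x
    · obtain ⟨x, rfl⟩ := hz
      obtain ⟨a, r, ha⟩ := hd.down x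
      refine ⟨a, .inj r (hX.refl _), fun a' r' => ?_⟩
      obtain e | ⟨x', r', hx⟩ := relHead_iff.1 r'
      · exact absurd e hS'.inj_ne_top
      · obtain hx | ⟨y, e, hx⟩ := hx.of_inj_inj hP hS'
        · exact bot_of r' hx a
        · cases e
          exact ha _ (hd.closed (hA.refl _) r' hx)
    · by_cases hz' : z = S'.top
      · obtain rfl := hz'
        obtain ⟨a, ha⟩ := hA.top
        exact ⟨a, .top _, fun a' _ => ha a'⟩
      · obtain ⟨a, ha⟩ := hA.bot
        refine ⟨a, rel_bot ha z, fun a' r' => ?_⟩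
        obtain e | ⟨x', r', hx⟩ := relHead_iff.1 r'
        · exact absurd e hz'
        · obtain hx | e | ⟨y, e, -⟩ := hx.of_inj hP hS'
          · exact bot_of r' hx a
          · exact absurd e hz'
          · exact absurd ⟨y, e⟩ hz
  · obtain ⟨x, r₁, hx⟩ := hd.up a
    -- The hypothesis is tested on the pair of `h` with the embedding of `a`.
    obtain e | ⟨x', r', hx'⟩ := relHead_iff.1 (r _ (.inj r₁ (hX.refl _)))
    · exact absurd e hS'.inj_ne_top
    · obtain hx | ⟨y, e, hxy⟩ := hx'.of_inj_inj hP hS'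
      · exact bot_of r' hx a
      · cases e
        exact hd.reflect fun b hb => hd.closed (hA.refl _) r' (hG.trans hxy (hx _ hb))

end

end

/-! ### Codes -/

section

variable {n : ℕ} {P : Base n} {k m l : ℕ}

theorem PrecCode.level {A : Code P k} {B : Code P m} (d : PrecCode A B) : k ≤ m := by
  cases d with
  | err | unk => assumption
  | diag d => exact d.level
  | head _ _ d => exact d.level

variable (hP : P.Good)
include hP

theorem PrecCode.irrel {A : Code P k} {B : Code P m} (d d' : PrecCode A B) : d = d' := by
  cases d with
  | err => cases d'; rfl
  | unk => cases d'; rfl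
  | diag d =>
    cases d' with
    | diag d' => rw [d.irrel hP d']
  | head h hA d =>
    cases d' with
    | head h' hA' d' =>
      obtain rfl := Head.hd_inj (hA.symm.trans hA')
      rw [d.irrel hP d']

theorem PrecCode.refl (A : Code P k) : Nonempty (PrecCode A A) := by
  cases A with
  | err => exact ⟨.err le_rfl _⟩
  | unk => exact ⟨.unk le_rfl⟩
  | ty A =>
    obtain ⟨d⟩ := PrecTy.refl hP A
    exact ⟨.diag d⟩

theorem PrecCode.le_unk (A : Code P k) (hkm : k ≤ m) (hm : m ≤ n) :
    Nonempty (PrecCode A (.unk : Code P m)) := by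
  cases A with
  | err => exact ⟨.err hkm _⟩
  | unk => exact ⟨.unk hkm⟩
  | ty A =>
    obtain ⟨h, hA⟩ := A.exists_head hkm hm
    obtain ⟨d⟩ := PrecTy.le_germ hP hkm hA
    exact ⟨.head h hA d⟩

/-- A composite that uses the rule `head` ends in the unknown type, which is above every code of
level at most `l`; the derivations to germs need not be composed. -/
theorem PrecCode.trans {A : Code P k} {B : Code P m} {C : Code P l} (hl : l ≤ n)
    (d : PrecCode A B) (e : PrecCode B C) : Nonempty (PrecCode A C) := by
  have hkl := d.level.trans e.level
  cases d with
  | err => exact ⟨.err hkl _⟩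
  | unk => cases e; exact ⟨.unk hkl⟩
  | diag d =>
    cases e with
    | diag e =>
      obtain ⟨f⟩ := d.trans hP e
      exact ⟨.diag f⟩
    | head => exact le_unk hP _ hkl hl
  | head h hA d => cases e; exact le_unk hP _ hkl hl

theorem PrecCode.antisymm {A B : Code P k} (d : PrecCode A B) (e : PrecCode B A) : A = B := by
  cases d with
  | err => cases e; rfl
  | unk => rfl
  | diag d =>
    cases e with
    | diag e => rw [d.antisymm hP e]
  | head => cases e

variable {S : UnkStr P k} {S' : UnkStr P m} {S'' : UnkStr P l}

theorem isBoundedOrder_leCode (hS : S.Good) (A : Code P k) : IsBoundedOrder (leCode S A) := by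
  cases A with
  | err =>
    exact ⟨fun _ => trivial, fun _ _ => trivial, fun _ _ => rfl, ⟨(), fun _ => trivial⟩,
      ⟨(), fun _ => trivial⟩⟩
  | unk => exact isBoundedOrder_unkLe hP hS
  | ty A => exact isBoundedOrder_leTy hP A

theorem isEpRel_relCode (hS : S.Good) (hS' : S'.Good) (hm : m ≤ n) {A : Code P k} {B : Code P m}
    (d : PrecCode A B) : IsEpRel (leCode S A) (leCode S' B) (RelCode S S' d) := by
  cases d with
  | err =>
    obtain ⟨b, hb⟩ := (isBoundedOrder_leCode hP hS' B).bot
    exact ⟨fun _ _ _ => trivial, fun _ => ⟨b, trivial, fun _ _ => hb _⟩,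
      fun _ => ⟨(), trivial, fun _ _ => trivial⟩, fun _ => trivial⟩
  | unk hkm => exact isEpRel_relUnk hP hS hS' hkm hm
  | diag d => exact isEpRel_relTy hP d
  | head h hA d => exact isEpRel_relHead hP d hS'

theorem relCode_self (hS : S.Good) {A : Code P k} (d : PrecCode A A) {a b} :
    RelCode S S d a b ↔ leCode S A a b := by
  cases d with
  | err => rfl
  | unk => exact relUnk_self hP hS
  | diag d => exact relTy_self hP d

theorem relCode_comp (hS : S.Good) (hS' : S'.Good) (hS'' : S''.Good) (hl : l ≤ n)
    {A : Code P k} {B : Code P m} {C : Code P l}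
    (d : PrecCode A B) (e : PrecCode B C) (f : PrecCode A C) {a c} :
    RelCode S S'' f a c ↔ ∃ b, RelCode S S' d a b ∧ RelCode S' S'' e b c := by
  have hm := e.level.trans hl
  cases d with
  | err =>
    cases f
    obtain ⟨b, hb⟩ := (isBoundedOrder_leCode hP hS' B).bot
    exact ⟨fun _ => ⟨b, trivial, (isEpRel_relCode hP hS' hS'' hl e).bot_left
      (isBoundedOrder_leCode hP hS'' C) hb c⟩, fun _ => trivial⟩
  | unk hkm =>
    cases e with
    | unk hml => cases f; exact relUnk_comp hP hS hS' hkm hml hm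
  | diag d =>
    cases e with
    | diag e => cases f with | diag f => exact relTy_comp hP d e f
    | head h hB e =>
      cases f with
      | head h' hA f =>
        obtain rfl := Head.hd_inj (hB.symm.trans (d.hd_eq.symm.trans hA))
        refine ⟨fun r => ?_, fun ⟨b, r, r'⟩ => ?_⟩
        · obtain rfl | ⟨x, r, hx⟩ := relHead_iff.1 r
          · obtain ⟨b, r, -⟩ := (isEpRel_relTy hP d).up a
            exact ⟨b, r, .top _⟩
          · obtain ⟨b, r, r'⟩ := (relTy_comp hP d e f).1 r
            exact ⟨b, r, .inj r' hx⟩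
        · obtain rfl | ⟨x, r', hx⟩ := relHead_iff.1 r'
          · exact RelHead.top _
          · exact RelHead.inj ((relTy_comp hP d e f).2 ⟨b, r, r'⟩) hx
  | head h hA d =>
    cases e with
    | unk hml =>
      cases f with
      | head h' hA' f =>
        have hh := hA.symm.trans hA'
        -- The relation from `A` to the larger germ factors through the germ at level `m`.
        obtain ⟨g⟩ := PrecTy.germ_le_germ hP hml hh
        refine ⟨fun r => ?_, fun ⟨b, r, r'⟩ => ?_⟩
        · obtain rfl | ⟨x, r, hx⟩ := relHead_iff.1 r
          · exact ⟨S'.top, .top _, .top _⟩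
          · obtain ⟨y, r, r'⟩ := (relTy_comp hP d g f).1 r
            exact ⟨S'.inj h y, .inj r ((isBoundedOrder_unkLe hP hS').refl _),
              (RelUnk.inj h h' hh g r').trans hP hS' hS'' ((relUnk_self hP hS'').2 hx)⟩
        · obtain rfl | ⟨x, r, hx⟩ := relHead_iff.1 r
          · rw [RelUnk.eq_top hS' r']
            exact RelHead.top _
          -- The middle element may be lowered to the pair of `h` and `x`, which can be inverted.
          · have r' := ((relUnk_self hP hS').2 hx).trans hP hS' hS' r'
            obtain hx | rfl | ⟨h₁, hh', d', x', rfl, r''⟩ := r'.of_inj hS'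
            · exact (isEpRel_relHead hP f hS'').bot_left (isBoundedOrder_unkLe hP hS'')
                ((isEpRel_relTy hP d).bot_of_bot (isBoundedOrder_leTy hP _) r
                  ((isErr_iff hP).1 hx)) c
            · exact RelHead.top _
            · obtain rfl := Head.hd_inj (hh.symm.trans hh')
              exact RelHead.inj ((relTy_comp hP d d' f).2 ⟨x, r, r''⟩)
                ((isBoundedOrder_unkLe hP hS'').refl _)

end

/-! ### The views of the codes and of their elements -/

/-- The properties of a universe hierarchy, together with the fact that the views are
isomorphisms. -/
structure Hier.Good {n : ℕ} (H : Hier n) : Prop where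
  base : H.toBase.Good
  str : ∀ i, (H.str i).Good
  view_bij : ∀ i, Function.Bijective (H.view (i := i))
  view_err : ∀ i, H.view (H.err i) = .err
  view_unk : ∀ i, H.view (H.unk i) = .unk
  elView_bij : ∀ {i} (A : H.U i), Function.Bijective (H.elView A)
  prec_iff : ∀ {i j} {A : H.U i} {B : H.U j},
    Nonempty (H.Prec A B) ↔ Nonempty (PrecCode (H.view A) (H.view B))
  le_iff : ∀ {i} {A : H.U i} {a b}, H.le A a b ↔ leCode (H.str i) _ (H.elView A a) (H.elView A b)
  rel_iff : ∀ {i j} {A : H.U i} {B : H.U j} (d : H.Prec A B)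
    (e : PrecCode (H.view A) (H.view B)) {a b},
    H.Rel d a b ↔ RelCode (H.str i) (H.str j) e (H.elView A a) (H.elView B b)

section

variable {n : ℕ} (H : Hier n)

/-- The view of the codes of levels `≤ n` as codes that refer to codes of levels `< n`. -/
def preView : {i : Lvl (n + 1)} → extU H i → Code H.toBase i.val
  | .last, A => A
  | .prev _, A => H.view A

/-- The unknown types of levels `≤ n`. -/
def preStr : (i : Lvl (n + 1)) → UnkStr H.toBase i.val
  | .last => unkStr H.toBase
  | .prev i => H.str i

/-- The view of the elements of codes of levels `≤ n`. -/
def preElView : {i : Lvl (n + 1)} → (A : extU H i) → extEl H A →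
    ElCode (preStr H i).X (preView H A)
  | .last, _, x => x
  | .prev _, A, x => H.elView A x

variable {H} (hH : H.Good)
include hH

theorem preStr_good : ∀ i, (preStr H i).Good
  | .last => unkStr_good _
  | .prev i => hH.str i

theorem preView_bijective : ∀ i, Function.Bijective (preView H (i := i))
  | .last => Function.bijective_id
  | .prev i => hH.view_bij i

theorem preElView_bijective : ∀ {i} (A : extU H i), Function.Bijective (preElView H A)
  | .last, _ => Function.bijective_id
  | .prev _, A => hH.elView_bij A

theorem preView_err : ∀ i, preView H ((extBase H).err i) = .err
  | .last => rfl
  | .prev i => hH.view_err i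

theorem preView_unk : ∀ i, preView H ((extBase H).unk i) = .unk
  | .last => rfl
  | .prev i => hH.view_unk i

/-- From level `n` down to a smaller level both sides are empty, the right one because derivations
do not lower levels. -/
theorem extPrec_iff : ∀ {i j} {A : extU H i} {B : extU H j},
    Nonempty (extPrec H A B) ↔ Nonempty (PrecCode (preView H A) (preView H B))
  | .last, .last, _, _ => Iff.rfl
  | .prev _, .last, _, _ => Iff.rfl
  | .last, .prev j, _, _ => ⟨fun ⟨d⟩ => (nomatch d), fun ⟨d⟩ => absurd d.level j.val_lt.not_ge⟩
  | .prev _, .prev _, _, _ => hH.prec_iff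

theorem extLe_iff : ∀ {i} {A : extU H i} {a b},
    extLe H A a b ↔ leCode (preStr H i) _ (preElView H A a) (preElView H A b)
  | .last, _, _, _ => Iff.rfl
  | .prev _, _, _, _ => hH.le_iff

theorem extPrec_irrel : ∀ {i j} {A : extU H i} {B : extU H j} (d d' : extPrec H A B), d = d'
  | .last, .last, _, _, d, d' => PrecCode.irrel hH.base d d'
  | .prev _, .last, _, _, d, d' => PrecCode.irrel hH.base d d'
  | .last, .prev _, _, _, d, _ => nomatch d
  | .prev _, .prev _, _, _, d, d' => hH.base.irrel d d'

theorem extRel_iff : ∀ {i j} {A : extU H i} {B : extU H j} (d : extPrec H A B)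
    (e : PrecCode (preView H A) (preView H B)) {a b}, extRel H d a b ↔
      RelCode (preStr H i) (preStr H j) e (preElView H A a) (preElView H B b)
  | .last, .last, _, _, d, e, _, _ => by rw [PrecCode.irrel hH.base e d]; rfl
  | .prev _, .last, _, _, d, e, _, _ => by rw [PrecCode.irrel hH.base e d]; rfl
  | .last, .prev _, _, _, d, _, _, _ => nomatch d
  | .prev _, .prev _, _, _, d, e, _, _ => hH.rel_iff d e

/-- Everything is transferred along `preView` and `preElView` from the results on codes over the old
base. These need levels at most `n` only. -/
theorem extBase_good : (extBase H).Good := by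
  have hP := hH.base
  have hS := preStr_good hH
  have order {i} (A : extU H i) : IsBoundedOrder (extLe H A) :=
    (isBoundedOrder_leCode hP (hS i) _).of_bijective (preElView_bijective hH A)
      fun _ _ => extLe_iff hH
  have toPre {i j} {A : extU H i} {B : extU H j} (d : extPrec H A B) :=
    (extPrec_iff hH (A := A) (B := B)).1 ⟨d⟩
  have lvl (i : Lvl (n + 1)) : i.val ≤ n := Nat.le_of_lt_succ i.val_lt
  refine ⟨fun d => ?_, fun A => ?_, fun d e => ?_, fun d e => ?_, extPrec_irrel hH,
    fun h A => ?_, fun {i j} h A => ?_, order, fun i x => ?_, fun d => ?_, fun d => ?_,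
    fun {i j k A B C} d e f => ?_⟩
  · exact (toPre d).some.level
  · exact (extPrec_iff hH).2 (PrecCode.refl hP _)
  · exact (extPrec_iff hH).2 (PrecCode.trans hP (lvl _) (toPre d).some (toPre e).some)
  · exact (preView_bijective hH _).1 (PrecCode.antisymm hP (toPre d).some (toPre e).some)
  · refine (extPrec_iff hH).2 ?_
    rw [preView_err hH]
    exact ⟨.err h _⟩
  · refine (extPrec_iff hH).2 ?_
    rw [preView_unk hH]
    exact PrecCode.le_unk hP _ h (lvl j)
  · cases i with
    | last => exact UnkLe.err x
    | prev i => exact hP.unkErr_le i x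
  · obtain ⟨e⟩ := toPre d
    exact (isEpRel_relCode hP (hS _) (hS _) (lvl _) e).of_bijective (preElView_bijective hH _)
      (preElView_bijective hH _) (fun _ _ => extLe_iff hH) (fun _ _ => extLe_iff hH)
      fun _ _ => extRel_iff hH d e
  · intro a a'
    obtain ⟨e⟩ := toPre d
    exact (extRel_iff hH d e).trans ((relCode_self hP (hS _) e).trans (extLe_iff hH).symm)
  · intro a c
    obtain ⟨d'⟩ := toPre d
    obtain ⟨e'⟩ := toPre e
    obtain ⟨f'⟩ := toPre f
    refine (extRel_iff hH f f').trans
      ((relCode_comp hP (hS i) (hS j) (hS k) (lvl k) d' e' f').trans ⟨?_, ?_⟩)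
    · rintro ⟨b, h, h'⟩
      obtain ⟨b, rfl⟩ := (preElView_bijective hH B).2 b
      exact ⟨b, (extRel_iff hH d d').2 h, (extRel_iff hH e e').2 h'⟩
    · rintro ⟨b, h, h'⟩
      exact ⟨_, (extRel_iff hH d d').1 h, (extRel_iff hH e e').1 h'⟩

end

/-! ### Codes of levels `≤ n` over the extended hierarchy -/

section

variable {n : ℕ} (H : Hier n) {k m : ℕ}

/-- The unknown type of a level `≤ n` over the extended hierarchy. -/
def extStr (hk : k ≤ n) (S : UnkStr H.toBase k) : UnkStr (extBase H) k where
  X := S.X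
  err := S.err
  top := S.top
  inj h x := S.inj (restrictHead H hk h x).1 (restrictHead H hk h x).2

theorem ext_str : ∀ i : Lvl (n + 1),
    (ext H).str i = extStr H (Nat.le_of_lt_succ i.val_lt) (preStr H i)
  | .last => rfl
  | .prev _ => rfl

/-- The bound on `k` serves surjectivity: a type of level at most `n` cannot refer to the new level
`n`. -/
theorem extTy_bijective (hk : k ≤ n) : Function.Bijective (extTy H (k := k)) := by
  refine ⟨fun A B h => ?_, fun A => ?_⟩
  · cases A <;> cases B <;> cases h <;> rfl
  · cases A with
    | nat => exact ⟨.nat, rfl⟩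
    | univ j h =>
      cases j with
      | last => exact absurd (show n < k from h) hk.not_gt
      | prev j => exact ⟨.univ j h, rfl⟩
    | pi i j h A B mon =>
      cases i with
      | last => exact absurd (show max n j.val + 1 = k from h) (by omega)
      | prev i =>
        cases j with
        | last => exact absurd (show max i.val n + 1 = k from h) (by omega)
        | prev j => exact ⟨.pi i j h A B mon, rfl⟩

theorem extCode_bijective (hk : k ≤ n) : Function.Bijective (extCode H (k := k)) := by
  refine ⟨fun A B h => ?_, fun A => ?_⟩
  · cases A <;> cases B <;> simp [extCode] at h ⊢
    exact (extTy_bijective H hk).1 h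
  · cases A with
    | err => exact ⟨.err, rfl⟩
    | unk => exact ⟨.unk, rfl⟩
    | ty A =>
      obtain ⟨A, rfl⟩ := (extTy_bijective H hk).2 A
      exact ⟨.ty A, rfl⟩

theorem extElTy_bijective (A : Ty H.toBase k) : Function.Bijective (extElTy H A) := by
  cases A <;> exact Function.bijective_id

theorem extElCode_bijective (X : Type) (A : Code H.toBase k) :
    Function.Bijective (extElCode H X A) := by
  cases A with
  | err => exact Function.bijective_id
  | unk => exact Function.bijective_id
  | ty A => exact extElTy_bijective H A

theorem extTy_hd (A : Ty H.toBase k) : (extTy H A).hd = A.hd := by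
  cases A <;> rfl

theorem leTy_ext {A : Ty H.toBase k} {x y} :
    leTy (extTy H A) (extElTy H A x) (extElTy H A y) ↔ leTy A x y := by
  cases A <;> rfl

theorem precTy_ext {A : Ty H.toBase k} {B : Ty H.toBase m} :
    Nonempty (PrecTy (extTy H A) (extTy H B)) ↔ Nonempty (PrecTy A B) := by
  refine ⟨fun ⟨d⟩ => ?_, fun ⟨d⟩ => ?_⟩
  · cases A <;> cases B <;> cases d
    · exact ⟨.nat ‹_›⟩
    · exact ⟨.univ ‹_› _ _ _⟩
    · exact ⟨.pi ‹_› ‹_› ‹_›⟩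
  · cases d with
    | nat h => exact ⟨.nat h⟩
    | univ h j h₁ h₂ => exact ⟨.univ h (.prev j) h₁ h₂⟩
    | pi h dom cod => exact ⟨@PrecTy.pi _ (extBase H) _ _ h _ _ _ _ _ _ _ _ _ _ _ _ dom cod⟩

/-- The two derivations are unrelated a priori; irrelevance identifies their components, and then
both relations unfold to the same one. -/
theorem relTy_ext (hP : H.toBase.Good) {A : Ty H.toBase k} {B : Ty H.toBase m} (d : PrecTy A B)
    (e : PrecTy (extTy H A) (extTy H B)) {x y} :
    RelTy e (extElTy H A x) (extElTy H B y) ↔ RelTy d x y := by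
  cases d with
  | nat => cases e; rfl
  | univ => cases e; rfl
  | pi _ dom cod =>
    cases e with
    | pi _ dom' cod' =>
      obtain rfl := hP.irrel dom dom'
      obtain rfl : cod = cod' := by
        funext a a' r
        exact hP.irrel _ _
      rfl

/-- A head of a level `≤ n`, over the extended hierarchy. -/
def extHead : Head n k → Head (n + 1) k
  | .nat => .nat
  | .univ j h => .univ (.prev j) h
  | .pi i h => .pi (.prev i) h

theorem extHead_hd (h : Head n k) : (extHead h).hd = h.hd := by
  cases h <;> rfl

theorem germ_extHead (h : Head n k) : germ (extBase H) (extHead h) = extTy H (germ H.toBase h) := by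
  cases h <;> rfl

/-- The elements of the germ of a head, over the extended hierarchy. -/
def extElGerm : (h : Head n k) → ElTy (germ H.toBase h) → ElTy (germ (extBase H) (extHead h))
  | .nat, x => x
  | .univ _ _, x => x
  | .pi _ _, x => x

theorem extStr_inj (hk : k ≤ n) (S : UnkStr H.toBase k) (h : Head n k) (x) :
    (extStr H hk S).inj (extHead h) (extElGerm H h x) = S.inj h x := by
  cases h <;> rfl

theorem exists_extHead (hk : k ≤ n) (h : Head (n + 1) k) : ∃ h₀ : Head n k, extHead h₀ = h := by
  cases h with
  | nat => exact ⟨.nat, rfl⟩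
  | univ j h =>
    cases j with
    | last => exact absurd (show n < k from h) hk.not_gt
    | prev j => exact ⟨.univ j h, rfl⟩
  | pi j h =>
    cases j with
    | last => exact absurd (show n + 1 = k from h) (by omega)
    | prev j => exact ⟨.pi j h, rfl⟩

theorem extElGerm_surjective (h : Head n k) : Function.Surjective (extElGerm H h) := by
  cases h <;> exact Function.surjective_id

theorem isErr_ext (h : Head n k) (x) :
    IsErr (extBase H) (extHead h) (extElGerm H h x) ↔ IsErr H.toBase h x := by
  cases h <;> rfl

theorem leTy_germ_ext {h : Head n k} {x y} :
    leTy (germ (extBase H) (extHead h)) (extElGerm H h x) (extElGerm H h y) ↔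
      leTy (germ H.toBase h) x y := by
  cases h <;> rfl

theorem precTy_germ_ext {A : Ty H.toBase k} {h : Head n m} :
    Nonempty (PrecTy (extTy H A) (germ (extBase H) (extHead h))) ↔
      Nonempty (PrecTy A (germ H.toBase h)) := by
  rw [germ_extHead, precTy_ext]

theorem relTy_germ_ext (hP : H.toBase.Good) {A : Ty H.toBase k} {h : Head n m}
    (d : PrecTy A (germ H.toBase h)) (e : PrecTy (extTy H A) (germ (extBase H) (extHead h)))
    {x y} : RelTy e (extElTy H A x) (extElGerm H h y) ↔ RelTy d x y := by
  cases h <;> exact relTy_ext H hP d e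

theorem relTy_germ_germ_ext (hP : H.toBase.Good) {h : Head n k} {h' : Head n m}
    (d : PrecTy (germ H.toBase h) (germ H.toBase h'))
    (e : PrecTy (germ (extBase H) (extHead h)) (germ (extBase H) (extHead h')))
    {x y} : RelTy e (extElGerm H h x) (extElGerm H h' y) ↔ RelTy d x y := by
  cases h <;> exact relTy_germ_ext H hP d e

theorem extStr_good (hk : k ≤ n) {S : UnkStr H.toBase k} (hS : S.Good) :
    (extStr H hk S).Good := by
  refine ⟨fun z => ?_, hS.top_ne_err, hS.inj_ne_top, fun {h x} => ?_, fun {h x h' x'} e => ?_⟩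
  · obtain h | h | ⟨h, x, rfl⟩ := hS.exhaust z
    · exact .inl h
    · exact .inr (.inl h)
    · exact .inr (.inr ⟨_, _, (extStr_inj H hk S h x).symm⟩)
  · obtain ⟨h, rfl⟩ := exists_extHead hk h
    obtain ⟨x, rfl⟩ := extElGerm_surjective H h x
    rw [extStr_inj, isErr_ext]
    exact hS.inj_eq_err
  · obtain ⟨h, rfl⟩ := exists_extHead hk h
    obtain ⟨x, rfl⟩ := extElGerm_surjective H h x
    obtain ⟨h', rfl⟩ := exists_extHead hk h'
    obtain ⟨x', rfl⟩ := extElGerm_surjective H h' x'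
    rw [extStr_inj, extStr_inj] at e
    rw [isErr_ext, isErr_ext]
    obtain h | e := hS.inj_inj e
    · exact .inl h
    · cases e
      exact .inr rfl

/-- Both orders have the same generators, since all heads of level `k ≤ n` and all elements of their
germs come from the old base. -/
theorem unkLe_ext (hk : k ≤ n) {S : UnkStr H.toBase k} {z w : S.X} :
    UnkLe (extStr H hk S) z w ↔ UnkLe S z w := by
  have forward (z w : (extStr H hk S).X) :
      UnkLe (extStr H hk S) z w → UnkLe S z w := by
    intro h
    cases h with
    | err => exact .err _
    | top => exact .top
    | inj h r =>
      obtain ⟨h, rfl⟩ := exists_extHead hk h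
      rename_i x x'
      obtain ⟨x, rfl⟩ := extElGerm_surjective H h x
      obtain ⟨x', rfl⟩ := extElGerm_surjective H h x'
      rw [extStr_inj, extStr_inj]
      exact .inj h ((leTy_germ_ext H).1 r)
    | inj_top => exact .inj_top _ _
  refine ⟨forward z w, fun h => ?_⟩
  cases h with
  | err => exact UnkLe.err (S := extStr H hk S) _
  | top => exact UnkLe.top (S := extStr H hk S)
  | inj h r =>
    rw [← extStr_inj H hk S, ← extStr_inj H hk S]
    exact .inj _ ((leTy_germ_ext H).2 r)
  | inj_top h x =>
    rw [← extStr_inj H hk S]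
    exact UnkLe.inj_top (S := extStr H hk S) _ _

theorem relUnk_ext (hP : H.toBase.Good) (hk : k ≤ n) (hm : m ≤ n) {S : UnkStr H.toBase k}
    {S' : UnkStr H.toBase m} {z : S.X} {w : S'.X} :
    RelUnk (extStr H hk S) (extStr H hm S') z w ↔ RelUnk S S' z w := by
  have key (h : Head n k) (h' : Head n m) :
      Nonempty (PrecTy (germ (extBase H) (extHead h)) (germ (extBase H) (extHead h'))) ↔
      Nonempty (PrecTy (germ H.toBase h) (germ H.toBase h')) := by
    rw [germ_extHead, germ_extHead, precTy_ext]
  have forward (z : (extStr H hk S).X) (w : (extStr H hm S').X) :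
      RelUnk (extStr H hk S) (extStr H hm S') z w → RelUnk S S' z w := by
    intro h
    cases h with
    | err => exact .err _
    | top => exact .top _
    | inj h h' hh d r =>
      obtain ⟨h, rfl⟩ := exists_extHead hk h
      obtain ⟨h', rfl⟩ := exists_extHead hm h'
      rename_i x x'
      obtain ⟨x, rfl⟩ := extElGerm_surjective H h x
      obtain ⟨x', rfl⟩ := extElGerm_surjective H h' x'
      obtain ⟨e⟩ := (key h h').1 ⟨d⟩
      rw [extStr_inj, extStr_inj]
      rw [extHead_hd, extHead_hd] at hh
      exact .inj h h' hh e ((relTy_germ_germ_ext H hP e d).1 r)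
  refine ⟨forward z w, fun h => ?_⟩
  cases h with
  | err => exact RelUnk.err (S := extStr H hk S) (S' := extStr H hm S') _
  | top => exact RelUnk.top (S := extStr H hk S) (S' := extStr H hm S') _
  | inj h h' hh d r =>
    obtain ⟨e⟩ := (key h h').2 ⟨d⟩
    rw [← extStr_inj H hk S, ← extStr_inj H hm S']
    exact .inj _ _ (by rwa [extHead_hd, extHead_hd]) e ((relTy_germ_germ_ext H hP d e).2 r)

theorem leCode_ext (hk : k ≤ n) {S : UnkStr H.toBase k} {A : Code H.toBase k} {x y} :
    leCode (extStr H hk S) (extCode H A) (extElCode H S.X A x) (extElCode H S.X A y) ↔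
      leCode S A x y := by
  cases A with
  | err => rfl
  | unk => exact unkLe_ext H hk
  | ty A => exact leTy_ext H

theorem precCode_ext (hm : m ≤ n) {A : Code H.toBase k} {B : Code H.toBase m} :
    Nonempty (PrecCode (extCode H A) (extCode H B)) ↔ Nonempty (PrecCode A B) := by
  refine ⟨fun ⟨d⟩ => ?_, fun ⟨d⟩ => ?_⟩
  · cases A with
    | err => exact ⟨.err d.level _⟩
    | unk =>
      cases B with
      | unk => exact ⟨.unk d.level⟩
      | _ => cases d
    | ty A =>
      cases B with
      | err => cases d
      | unk =>
        cases d with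
        | head h hA d =>
          obtain ⟨h, rfl⟩ := exists_extHead hm h
          obtain ⟨e⟩ := (precTy_germ_ext H).1 ⟨d⟩
          rw [extTy_hd, extHead_hd] at hA
          exact ⟨.head h hA e⟩
      | ty B =>
        cases d with
        | diag d =>
          obtain ⟨e⟩ := (precTy_ext H).1 ⟨d⟩
          exact ⟨.diag e⟩
  · cases d with
    | err h => exact ⟨.err h _⟩
    | unk h => exact ⟨.unk h⟩
    | diag d =>
      obtain ⟨e⟩ := (precTy_ext H).2 ⟨d⟩
      exact ⟨.diag e⟩
    | head h hA d =>
      obtain ⟨e⟩ := (precTy_germ_ext H).2 ⟨d⟩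
      exact ⟨.head (extHead h) (by rwa [extTy_hd, extHead_hd]) e⟩

theorem relCode_ext (hP : H.toBase.Good) (hk : k ≤ n) (hm : m ≤ n)
    {S : UnkStr H.toBase k} {S' : UnkStr H.toBase m} {A : Code H.toBase k} {B : Code H.toBase m}
    (d : PrecCode A B) (e : PrecCode (extCode H A) (extCode H B)) {x y} :
    RelCode (extStr H hk S) (extStr H hm S') e (extElCode H S.X A x) (extElCode H S'.X B y) ↔
      RelCode S S' d x y := by
  cases d with
  | err => cases e; rfl
  | unk => cases e; exact relUnk_ext H hP hk hm
  | diag d => cases e with | diag e => exact relTy_ext H hP d e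
  | head h hA d =>
    cases e with
    | head h' hA' e =>
      -- Both heads are the head of `A`, and a head of a given level is determined by its
      -- constructor.
      obtain rfl : h' = extHead h := Head.hd_inj <| by
        rw [← hA', extTy_hd, extHead_hd, hA]
      refine relHead_iff.trans (Iff.trans ?_ relHead_iff.symm)
      refine or_congr Iff.rfl ⟨fun ⟨z, r, hz⟩ => ?_, fun ⟨z, r, hz⟩ => ?_⟩
      · obtain ⟨z, rfl⟩ := extElGerm_surjective H h z
        rw [extStr_inj] at hz
        exact ⟨z, (relTy_germ_ext H hP d e).1 r, (unkLe_ext H hm).1 hz⟩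
      · refine ⟨extElGerm H h z, (relTy_germ_ext H hP d e).2 r, ?_⟩
        rw [extStr_inj]
        exact (unkLe_ext H hm).2 hz

end

/-! ### The hierarchy -/

section

variable {n : ℕ} {H : Hier n}

theorem ext_view : ∀ {i : Lvl (n + 1)} (A : extU H i), (ext H).view A = extCode H (preView H A)
  | .last, _ => rfl
  | .prev _, _ => rfl

/-- Adding a level preserves the properties of the hierarchy. -/
theorem ext_good (hH : H.Good) : (ext H).Good := by
  have hP := hH.base
  have lvl (i : Lvl (n + 1)) : i.val ≤ n := Nat.le_of_lt_succ i.val_lt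
  refine ⟨extBase_good hH, fun i => ?_, fun i => ?_, fun i => ?_, fun i => ?_, fun {i} A => ?_,
    fun {i j A B} => ?_, fun {i A a b} => ?_, fun {i j A B} d e {a b} => ?_⟩
  · rw [ext_str]
    exact extStr_good H (lvl i) (preStr_good hH i)
  · have : (ext H).view (i := i) = extCode H ∘ preView H := funext ext_view
    rw [this]
    exact (extCode_bijective H (lvl i)).comp (preView_bijective hH i)
  · exact (ext_view _).trans (congrArg (extCode H) (preView_err hH i))
  · exact (ext_view _).trans (congrArg (extCode H) (preView_unk hH i))
  · have := (extElCode_bijective H _ (preView H A)).comp (preElView_bijective hH A)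
    cases i <;> exact this
  · refine (extPrec_iff hH).trans ((precCode_ext H (lvl j)).symm.trans ?_)
    cases i <;> cases j <;> rfl
  · refine (extLe_iff hH).trans ((leCode_ext H (lvl i)).symm.trans ?_)
    cases i <;> rfl
  -- The derivation `d'` over the old base mediates: `extRel_iff` relates it to `d`, and
  -- `relCode_ext` to `e`.
  · obtain ⟨d'⟩ := (extPrec_iff hH).1 ⟨d⟩
    refine (extRel_iff hH d d').trans ?_
    cases i <;> cases j <;> exact (relCode_ext H hP (lvl _) (lvl _) d' e).symm

end

theorem empty_good : empty.Good := by
  constructor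
  · constructor <;> intro i <;> exact nomatch i
  all_goals intro i; exact nomatch i

theorem hier_good : ∀ n, (hier n).Good
  | 0 => empty_good
  | n + 1 => ext_good (hier_good n)

/-- Eliminating `q : Ident a a` uses Axiom K, available for every type because Lean's equality is
proof-irrelevant; nothing about codes enters. -/
theorem uip (α : Type) : UIP α := by
  intro a b p q
  cases p
  cases q
  rfl

end MonotoneModel

theorem mainTheorem10 (N : ℕ) :
    -- (1) precision between codes is a proof-irrelevant partial order
    ((∀ (i : MonotoneModel.Lvl N) (A : (MonotoneModel.hier N).U i), Nonempty ((MonotoneModel.hier N).Prec A A)) ∧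
      (∀ (i j k : MonotoneModel.Lvl N) (A : (MonotoneModel.hier N).U i) (B : (MonotoneModel.hier N).U j) (C : (MonotoneModel.hier N).U k),
        (MonotoneModel.hier N).Prec A B → (MonotoneModel.hier N).Prec B C → Nonempty ((MonotoneModel.hier N).Prec A C)) ∧
      (∀ (i j : MonotoneModel.Lvl N) (A : (MonotoneModel.hier N).U i) (B : (MonotoneModel.hier N).U j),
        (MonotoneModel.hier N).Prec A B → (MonotoneModel.hier N).Prec B A →
          (⟨i, A⟩ : (i : MonotoneModel.Lvl N) × (MonotoneModel.hier N).U i) = ⟨j, B⟩) ∧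
      (∀ (i j : MonotoneModel.Lvl N) (A : (MonotoneModel.hier N).U i) (B : (MonotoneModel.hier N).U j) (d d' : (MonotoneModel.hier N).Prec A B), d = d')) ∧
    -- (2) the error type is the bottom and the unknown type is the top
    (∀ (i : MonotoneModel.Lvl N) (A : (MonotoneModel.hier N).U i),
      Nonempty ((MonotoneModel.hier N).Prec ((MonotoneModel.hier N).err i) A) ∧
        Nonempty ((MonotoneModel.hier N).Prec A ((MonotoneModel.hier N).unk i))) ∧
    -- (3) the decoding is a family of (bipointed) posets, with ep-pairs between them
    ((∀ (i : MonotoneModel.Lvl N) (A : (MonotoneModel.hier N).U i),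
        IsPartialOrder ((MonotoneModel.hier N).El A) ((MonotoneModel.hier N).le A) ∧
          (∃ a, ∀ x, (MonotoneModel.hier N).le A a x) ∧ (∃ a, ∀ x, (MonotoneModel.hier N).le A x a)) ∧
      (∀ (i j : MonotoneModel.Lvl N) (A : (MonotoneModel.hier N).U i) (B : (MonotoneModel.hier N).U j) (d : (MonotoneModel.hier N).Prec A B),
        MonotoneModel.IsEpPair ((MonotoneModel.hier N).le A) ((MonotoneModel.hier N).le B) ((MonotoneModel.hier N).Rel d)) ∧
      (∀ (i : MonotoneModel.Lvl N) (A : (MonotoneModel.hier N).U i) (d : (MonotoneModel.hier N).Prec A A) (a a' : (MonotoneModel.hier N).El A),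
        (MonotoneModel.hier N).Rel d a a' ↔ (MonotoneModel.hier N).le A a a') ∧
      (∀ (i j k : MonotoneModel.Lvl N) (A : (MonotoneModel.hier N).U i) (B : (MonotoneModel.hier N).U j) (C : (MonotoneModel.hier N).U k)
        (d : (MonotoneModel.hier N).Prec A B) (e : (MonotoneModel.hier N).Prec B C) (f : (MonotoneModel.hier N).Prec A C)
        (a : (MonotoneModel.hier N).El A) (c : (MonotoneModel.hier N).El C),
        (MonotoneModel.hier N).Rel f a c ↔ ∃ b, (MonotoneModel.hier N).Rel d a b ∧ (MonotoneModel.hier N).Rel e b c)) ∧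
    -- (4) uniqueness of identity proofs
    (∀ (i : MonotoneModel.Lvl N), MonotoneModel.UIP ((MonotoneModel.hier N).U i) ∧ ∀ A : (MonotoneModel.hier N).U i, MonotoneModel.UIP ((MonotoneModel.hier N).El A)) := by
  have hH := MonotoneModel.hier_good N
  have hP := hH.base
  refine ⟨⟨fun i A => hP.refl A, fun i j k A B C d e => hP.trans d e, fun i j A B d e => ?_,
    fun i j A B => hP.irrel⟩, fun i A => ⟨hP.err_le le_rfl A, hP.le_unk le_rfl A⟩,
    ⟨fun i A => ⟨?_, (hP.order A).bot, (hP.order A).top⟩,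
      fun i j A B d => (hP.ep d).isEpPair (hP.order A) (hP.order B),
      fun i A d a a' => hP.rel_self d, fun i j k A B C d e f a c => hP.rel_comp d e f⟩,
    fun i => ⟨MonotoneModel.uip _, fun A => MonotoneModel.uip _⟩⟩
  -- Derivations never lower the level, so two opposite ones force equal levels and antisymmetry
  -- within one level suffices.
  · obtain rfl := MonotoneModel.Lvl.val_inj (le_antisymm (hP.level d) (hP.level e))
    rw [hP.antisymm d e]
  · have h := hP.order A
    exact { refl := h.refl, trans := fun _ _ _ => h.trans, antisymm := fun _ _ => h.antisymm }
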